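/- Let $\sigma=\{s\in\mathbb C:\operatorname{Re}s=\tfrac12\}$. For complex-valued $f\in L_2(\mathbb R_+)$ let $f^*(s)=\int_0^\infty f(t)t^{s-1}\,dt$, $s\in\sigma$, be its Mellin transform, where the integral is the limit in $L_2(\sigma)$ of the integrals over $[1/N,N]$ as $N\to\infty$. For a function $F$ on $\sigma$ such that $\tau\mapsto F(\frac12+i\tau)$ is locally integrable, the formula $f(x)=\frac1{2\pi i}\int_\sigma F(s)x^{-s}\,ds$ in the mean square sense means that the integrals over $\{\frac12+i\tau:|\tau|\le N\}$ converge to $f$ in $L_2(\mathbb R_+)$ as $N\to\infty$. Singular integrals are Cauchy principal values (the limit as $\varepsilon\to0^+$ of the integral over the $t>0$ at distance greater than $\varepsilon$ from the singular point), and an equation is said to be solved by $f$ if, for almost all $x>0$, the principal value exists and the equation holds. For every $f\in L_2(\mathbb R_+)$ the following four conditions are equivalent: (a) $f$ solves $\displaystyle\frac1x f\Big(\frac1x\Big)=\frac2\pi\,\mathrm{PV}\!\int_0^\infty\frac{t f(t)}{t^2-x^2}\,dt$, $x>0$; (b) $f$ solves $\displaystyle f(x)=\frac2\pi\,\mathrm{PV}\!\int_0^\infty\frac{xt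 f(t)}{x^2t^2-1}\,dt$, $x>0$; (c) there is a function $\varphi$ on $\sigma$ with $\varphi(s)=\varphi(1-s)$ for all $s\in\sigma$ such that $\displaystyle f(x)=\frac1{2\pi i}\int_\sigma\frac{\varphi(s)}{\cos(\pi s/2)}x^{-s}\,ds$ in the mean square sense; (d) there is a function $\varphi$ on $\sigma$ with $\varphi(s)=\varphi(1-s)$ for all $s\in\sigma$ such that $f^*(s)=\varphi(s)/\cos(\pi s/2)$ for almost all $s\in\sigma$. Analogously, for every $f\in L_2(\mathbb R_+)$ the following four conditions are equivalent: (a') $f$ solves $\displaystyle\frac1x f\Big(\frac1x\Big)=\frac2\pi\,\mathrm{PV}\!\int_0^\infty\frac{x f(t)}{x^2-t^2}\,dt$, $x>0$; (b') $f$ solves $\displaystyle f(x)=\frac2\pi\,\mathrm{PV}\!\int_0^\infty\frac{f(t)}{1-x^2t^2}\,dt$, $x>0$; (c') there is a function $\rho$ on $\sigma$ with $\rho(s)=\rho(1-s)$ for all $s\in\sigma$ such that $\displaystyle f(x)=\frac1{2\pi i}\int_\sigma\frac{\rho(s)}{\sin(\pi s/2)}x^{-s}\,ds$ in the mean square sense;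 (d') there is a function $\rho$ on $\sigma$ with $\rho(s)=\rho(1-s)$ for all $s\in\sigma$ such that $f^*(s)=\rho(s)/\sin(\pi s/2)$ for almost all $s\in\sigma$. -/

import Mathlib

open MeasureTheory Filter Topology Set

/-- The point `1/2 + i τ` of the critical line. -/
noncomputable def critPt (τ : ℝ) : ℂ := 1 / 2 + (τ : ℂ) * Complex.I

/-- `f` belongs to (complex) `L₂` of the half-line `(0, ∞)`; values of `f` elsewhere are ignored. -/
def MemL2HalfLine (f : ℝ → ℂ) : Prop := MemLp f 2 (volume.restrict (Ioi (0 : ℝ)))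

/-- The Cauchy principal value of `∫₀^∞ k(t) dt`, with a singularity at `t = a`, exists and
equals `v`: the integrals over `{t > 0 : |t - a| > ε}` converge absolutely and tend to `v`
as `ε → 0+`. -/
def HasPVIntegral (k : ℝ → ℂ) (a : ℝ) (v : ℂ) : Prop :=
  (∀ ε : ℝ, 0 < ε → IntegrableOn k {t : ℝ | 0 < t ∧ ε < |t - a|}) ∧
  Tendsto (fun ε : ℝ => ∫ t in {t : ℝ | 0 < t ∧ ε < |t - a|}, k t) (𝓝[>] 0) (𝓝 v)

/-- `(1/x) f(1/x) = (2/π) PV ∫₀^∞ t f(t) / (t² - x²) dt` for almost all `x > 0`. -/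
def SolvesReflectedCot (f : ℝ → ℂ) : Prop :=
  ∀ᵐ x : ℝ ∂(volume.restrict (Ioi (0 : ℝ))), ∃ v : ℂ,
    HasPVIntegral (fun t => (t : ℂ) * f t / ((t : ℂ) ^ 2 - (x : ℂ) ^ 2)) x v ∧
    1 / (x : ℂ) * f (1 / x) = 2 / (Real.pi : ℂ) * v

/-- `(1/x) f(1/x) = (2/π) PV ∫₀^∞ x f(t) / (x² - t²) dt` for almost all `x > 0`. -/
def SolvesReflectedTan (f : ℝ → ℂ) : Prop :=
  ∀ᵐ x : ℝ ∂(volume.restrict (Ioi (0 : ℝ))), ∃ v : ℂ,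
    HasPVIntegral (fun t => (x : ℂ) * f t / ((x : ℂ) ^ 2 - (t : ℂ) ^ 2)) x v ∧
    1 / (x : ℂ) * f (1 / x) = 2 / (Real.pi : ℂ) * v

/-- `f(x) = (2/π) PV ∫₀^∞ x t f(t) / (x² t² - 1) dt` for almost all `x > 0`
(the singularity is at `t = 1/x`). -/
def SolvesSecondKindCot (f : ℝ → ℂ) : Prop :=
  ∀ᵐ x : ℝ ∂(volume.restrict (Ioi (0 : ℝ))), ∃ v : ℂ,
    HasPVIntegral (fun t => (x : ℂ) * (t : ℂ) * f t / ((x : ℂ) ^ 2 * (t : ℂ) ^ 2 - 1)) (1 / x) v ∧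
    f x = 2 / (Real.pi : ℂ) * v

/-- `f(x) = (2/π) PV ∫₀^∞ f(t) / (1 - x² t²) dt` for almost all `x > 0`
(the singularity is at `t = 1/x`). -/
def SolvesSecondKindTan (f : ℝ → ℂ) : Prop :=
  ∀ᵐ x : ℝ ∂(volume.restrict (Ioi (0 : ℝ))), ∃ v : ℂ,
    HasPVIntegral (fun t => f t / (1 - (x : ℂ) ^ 2 * (t : ℂ) ^ 2)) (1 / x) v ∧
    f x = 2 / (Real.pi : ℂ) * v

/-- `F`, restricted to the line `Re s = 1/2`, is the `L₂` Mellin transform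
`f*(s) = ∫₀^∞ f(t) t^(s-1) dt` of `f`: it is square integrable on that line, and the integrals
over `[1/N, N]` tend to it in mean square as `N → ∞`. -/
def IsMellinTransformL2 (f : ℝ → ℂ) (F : ℂ → ℂ) : Prop :=
  MemLp (fun τ : ℝ => F (critPt τ)) 2 volume ∧
  Tendsto (fun N : ℝ => eLpNorm (fun τ : ℝ =>
      (∫ t in Icc (1 / N) N, f t * (t : ℂ) ^ (critPt τ - 1)) - F (critPt τ)) 2 volume)
    atTop (𝓝 0)

/-- `f(x) = (1/(2πi)) ∫_σ F(s) x^(-s) ds`, the integral over the line `σ : Re s = 1/2` being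
convergent in the mean square sense: `F` is locally integrable on `σ`, and the integrals over
`{1/2 + iτ : |τ| ≤ N}` (with `ds = i dτ`) tend to `f` in `L₂(0, ∞)` as `N → ∞`. -/
def IsMeanSquareMellinIntegral (F : ℂ → ℂ) (f : ℝ → ℂ) : Prop :=
  LocallyIntegrable (fun τ : ℝ => F (critPt τ)) volume ∧
  Tendsto (fun N : ℝ => eLpNorm (fun x : ℝ =>
      f x - 1 / (2 * (Real.pi : ℂ)) * ∫ τ in Icc (-N) N, F (critPt τ) * (x : ℂ) ^ (-critPt τ))
        2 (volume.restrict (Ioi (0 : ℝ))))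
    atTop (𝓝 0)

/-- `φ(s) = φ(1 - s)` on the line `Re s = 1/2`. -/
def SymmetricOnCritLine (φ : ℂ → ℂ) : Prop := ∀ s : ℂ, s.re = 1 / 2 → φ s = φ (1 - s)

/-! In the variable t = e^{-u}, put g(u) = e^{-u/2} f(e^{-u}) (`logPull`). This is an isometry from
L₂(0, ∞) onto L₂(ℝ), and at s = 1/2 + 2πiξ the Mellin transform of f is the L² Fourier transform
ĝ(ξ). Both Mellin conditions say that φ(s)/cos(πs/2), or ρ(s)/sin(πs/2), equals ĝ almost everywhere
(`isMeanSquareMellinIntegral_iff`, `isMellinTransformL2_iff`). A symmetric numerator exists exactly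
when ĝ times the denominator is even in ξ, because s ↦ 1 - s is ξ ↦ -ξ
(`exists_symmetric_div_ae_eq_iff`).

On the side of the equations, (1/x) f(1/x) corresponds to g(-u), hence to ĝ(-ξ). By partial
fractions the singular integral is, up to a constant, the Hilbert transform b of the odd extension
of f (first equation) or the even one (second). It remains to see that on the Mellin side this is
multiplication by cot(πs/2), respectively tan(πs/2).

The singular multiplier is not computed directly. A conjugate pair a, b satisfies ∫ a(t)
(x-t)/((x-t)²+ε²) dt = ∫ b(t) ε/((x-t)²+ε²) dt and a companion formula with the roles exchanged
(`exists_conjugate_function`). At x = 0 parity folds these to identities on the half-line with the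
regular kernels t/(t²+ε²) and ε/(t²+ε²) (`exists_halfLine_hilbert`). With ε = e^{-v} they are
correlations with one integrable kernel `logKer` and its reflection, whose transforms are
(π/2)/cos(πs/2) and (π/2)/sin(πs/2) by Euler's reflection formula. Comparing transforms gives the
multiplier (`fourier_logPull_mul_critCos_ae_eq`).

That the principal values exist almost everywhere and equal πb is the Lebesgue point argument:
truncated Hilbert integrals differ from conjugate Poisson integrals by at most a Poisson mean of |a
- a(x)| (`ae_tendsto_truncated_hilbert`). -/

open scoped ENNReal FourierTransform SchwartzMap

/-! ### The Fourier transform on L²(ℝ) and its agreement with Fourier integrals. -/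

/-- Locally integrable functions on the line agreeing as functionals on Schwartz functions agree
almost everywhere. -/
theorem ae_eq_of_integral_schwartz_mul_eq {a b : ℝ → ℂ} (ha : LocallyIntegrable a)
    (hb : LocallyIntegrable b)
    (h : ∀ ψ : 𝓢(ℝ, ℂ), ∫ x, ψ x * a x = ∫ x, ψ x * b x) : a =ᵐ[volume] b := by
  refine ae_eq_of_integral_contDiff_smul_eq ha hb fun g hg hc => ?_
  have hg₁ : HasCompactSupport (Complex.ofRealCLM ∘ g) := hc.comp_left rfl
  have hg₂ : ContDiff ℝ ((⊤ : ℕ∞) : WithTop ℕ∞) (Complex.ofRealCLM ∘ g) := by fun_prop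
  simpa using h (hg₁.toSchwartzMap hg₂)

theorem Lp.locallyIntegrable_two (a : Lp ℂ 2 (volume : Measure ℝ)) : LocallyIntegrable a :=
  (Lp.memLp a).locallyIntegrable (by norm_num)

/-- The L² transform agrees with the distributional one; this pairing is the bridge between it and
explicit integrals. -/
theorem integral_schwartz_mul_fourier (a : Lp ℂ 2 (volume : Measure ℝ)) (ψ : 𝓢(ℝ, ℂ)) :
    ∫ x, ψ x * (𝓕 a : Lp ℂ 2 (volume : Measure ℝ)) x = ∫ x, 𝓕 ψ x * a x := by
  have h := congrArg (fun T => T ψ) (Lp.fourier_toTemperedDistribution_eq a)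
  simp only [TemperedDistribution.fourier_apply, Lp.toTemperedDistribution_apply, smul_eq_mul] at h
  exact h.symm

theorem integral_fourier_mul_eq {a b : ℝ → ℂ} (ha : Integrable a) (hb : Integrable b) :
    ∫ x, 𝓕 a x * b x = ∫ x, a x * 𝓕 b x := by
  have := VectorFourier.integral_fourierIntegral_smul_eq_flip (L := innerₗ ℝ)
    Real.continuous_fourierChar (by fun_prop) ha hb
  simp only [flip_innerₗ, smul_eq_mul] at this
  exact this

/-- On `L¹ ∩ L²` the Fourier integral represents the `L²` Fourier transform. -/
theorem fourier_toLp_ae_eq {h : ℝ → ℂ} (h1 : Integrable h) (h2 : MemLp h 2) :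
    (𝓕 (h2.toLp h) : Lp ℂ 2 (volume : Measure ℝ)) =ᵐ[volume] 𝓕 h := by
  have hc : Continuous (𝓕 h) := VectorFourier.fourierIntegral_continuous
    Real.continuous_fourierChar (by fun_prop) h1
  refine ae_eq_of_integral_schwartz_mul_eq (Lp.locallyIntegrable_two _) hc.locallyIntegrable
    fun ψ => ?_
  rw [integral_schwartz_mul_fourier, ← integral_fourier_mul_eq ψ.integrable h1,
    SchwartzMap.fourier_coe]
  refine integral_congr_ae ?_
  filter_upwards [h2.coeFn_toLp] with x hx
  rw [hx]

/-- An integrable function whose inverse Fourier integral is square integrable is the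
`L²` Fourier transform of that integral. -/
theorem ae_eq_fourier_of_fourierInv_ae_eq {G : ℝ → ℂ} (hG : Integrable G)
    (b : Lp ℂ 2 (volume : Measure ℝ)) (hb : 𝓕⁻ G =ᵐ[volume] b) :
    G =ᵐ[volume] (𝓕 b : Lp ℂ 2 (volume : Measure ℝ)) := by
  refine ae_eq_of_integral_schwartz_mul_eq hG.locallyIntegrable (Lp.locallyIntegrable_two _)
    fun ψ => ?_
  rw [integral_schwartz_mul_fourier]
  have h1 : ∫ x, 𝓕 ψ x * b x = ∫ x, 𝓕 ψ x * 𝓕⁻ G x :=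
    integral_congr_ae (by filter_upwards [hb] with x hx; rw [hx])
  -- With the test function written as a Fourier transform, the multiplication formula for
  -- integrable functions moves the transform onto `G`.
  have hψ : ψ = 𝓕 (𝓕⁻ ψ) := (FourierTransform.fourier_fourierInv_eq ψ).symm
  have h2 : ∀ x, 𝓕 ψ x = 𝓕⁻ ψ (-x) := by
    intro x
    rw [SchwartzMap.fourier_coe, SchwartzMap.fourierInv_coe, Real.fourierInv_eq_fourier_neg,
      neg_neg]
  rw [h1]
  calc ∫ x, ψ x * G x = ∫ x, 𝓕 (𝓕⁻ ψ : 𝓢(ℝ, ℂ)) x * G x := by rw [← hψ]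
    _ = ∫ x, (𝓕⁻ ψ : 𝓢(ℝ, ℂ)) x * 𝓕 G x := by
        rw [SchwartzMap.fourier_coe, integral_fourier_mul_eq (𝓕⁻ ψ).integrable hG]
    _ = ∫ x, (𝓕⁻ ψ : 𝓢(ℝ, ℂ)) (-x) * 𝓕 G (-x) :=
        (integral_neg_eq_self (fun x => (𝓕⁻ ψ : 𝓢(ℝ, ℂ)) x * 𝓕 G x) volume).symm
    _ = ∫ x, 𝓕 ψ x * 𝓕⁻ G x := by
        refine integral_congr_ae (.of_forall fun x => ?_)
        simp only [h2, Real.fourierInv_eq_fourier_neg]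

/-- An integrable function with vanishing inverse Fourier integral vanishes almost everywhere. -/
theorem ae_eq_zero_of_fourierInv_eq_zero {G : ℝ → ℂ} (hG : Integrable G) (h : ∀ x, 𝓕⁻ G x = 0) :
    G =ᵐ[volume] 0 := by
  have h0 := ae_eq_fourier_of_fourierInv_ae_eq hG 0
    (by filter_upwards [Lp.coeFn_zero ℂ 2 (volume : Measure ℝ)] with x hx; rw [h, hx]; rfl)
  have : (𝓕 (0 : Lp ℂ 2 (volume : Measure ℝ))) = 0 := (Lp.fourierTransformₗᵢ ℝ ℂ).map_zero
  rw [this] at h0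
  exact h0.trans (Lp.coeFn_zero _ _ _)

/-- Hölder's inequality; this continuity lets the multiplication formula pass by density from
Schwartz functions to all of L². -/
theorem continuous_integral_mul_left (b : Lp ℂ 2 (volume : Measure ℝ)) :
    Continuous fun a : Lp ℂ 2 (volume : Measure ℝ) => ∫ x, b x * a x := by
  have h := (((ContinuousLinearMap.mul ℂ ℂ).lpPairing volume 2 2) b).continuous
  refine h.congr fun a => ?_
  simpa using ContinuousLinearMap.lpPairing_eq_integral (ContinuousLinearMap.mul ℂ ℂ) b a

/-- The multiplication formula for the `L²` Fourier transform. -/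
theorem integral_mul_fourier_eq (a b : Lp ℂ 2 (volume : Measure ℝ)) :
    ∫ x, b x * (𝓕 a : Lp ℂ 2 (volume : Measure ℝ)) x =
      ∫ x, (𝓕 b : Lp ℂ 2 (volume : Measure ℝ)) x * a x := by
  refine DenseRange.induction_on
    (p := fun a : Lp ℂ 2 (volume : Measure ℝ) =>
      ∫ x, b x * (𝓕 a : Lp ℂ 2 (volume : Measure ℝ)) x =
      ∫ x, (𝓕 b : Lp ℂ 2 (volume : Measure ℝ)) x * a x)
    (SchwartzMap.denseRange_toLpCLM (p := 2) ENNReal.ofNat_ne_top) a ?_ fun ψ => ?_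
  · exact isClosed_eq ((continuous_integral_mul_left b).comp
      (Lp.fourierTransformₗᵢ ℝ ℂ).continuous) (continuous_integral_mul_left _)
  · have e1 : (𝓕 (SchwartzMap.toLpCLM ℝ (E := ℝ) ℂ 2 volume ψ) : Lp ℂ 2 (volume : Measure ℝ)) =
        (𝓕 ψ).toLp 2 := SchwartzMap.toLp_fourier_eq ψ
    rw [e1]
    calc _ = ∫ x, 𝓕 ψ x * b x := by
          refine integral_congr_ae ?_
          filter_upwards [(𝓕 ψ).coeFn_toLp 2 volume] with x hx
          rw [hx, mul_comm]
      _ = ∫ x, ψ x * (𝓕 b : Lp ℂ 2 (volume : Measure ℝ)) x :=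
          (integral_schwartz_mul_fourier b ψ).symm
      _ = _ := by
          refine integral_congr_ae ?_
          filter_upwards [ψ.coeFn_toLp 2 volume] with x hx
          rw [SchwartzMap.toLpCLM_apply, hx, mul_comm]

/-- The multiplication formula for the Fourier transform, between `L²` and `L¹ ∩ L²`. -/
theorem integral_mul_fourierIntegral_eq (a : Lp ℂ 2 (volume : Measure ℝ)) {h : ℝ → ℂ}
    (h1 : Integrable h) (h2 : MemLp h 2) :
    ∫ x, a x * 𝓕 h x = ∫ x, (𝓕 a : Lp ℂ 2 (volume : Measure ℝ)) x * h x := by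
  calc ∫ x, a x * 𝓕 h x
      = ∫ x, a x * (𝓕 (h2.toLp h) : Lp ℂ 2 (volume : Measure ℝ)) x := by
        refine integral_congr_ae ?_
        filter_upwards [fourier_toLp_ae_eq h1 h2] with x hx
        rw [hx]
    _ = _ := by
        rw [integral_mul_fourier_eq]
        refine integral_congr_ae ?_
        filter_upwards [h2.coeFn_toLp] with x hx
        rw [hx]

/-- The Fourier transform commutes with the reflection `x ↦ -x`. -/
theorem fourier_comp_neg_ae_eq (a b : Lp ℂ 2 (volume : Measure ℝ))
    (h : ∀ᵐ x, b x = a (-x)) :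
    ∀ᵐ x, (𝓕 b : Lp ℂ 2 (volume : Measure ℝ)) x = (𝓕 a : Lp ℂ 2 (volume : Measure ℝ)) (-x) := by
  have hl : LocallyIntegrable fun x => (𝓕 a : Lp ℂ 2 (volume : Measure ℝ)) (-x) :=
    ((Lp.memLp _).comp_measurePreserving (Measure.measurePreserving_neg volume)).locallyIntegrable
      (by norm_num)
  refine ae_eq_of_integral_schwartz_mul_eq (Lp.locallyIntegrable_two _) hl fun ψ => ?_
  have e : ∀ x, 𝓕⁻ ψ x = 𝓕 ψ (-x) := fun x => by
    rw [SchwartzMap.fourier_coe, SchwartzMap.fourierInv_coe, Real.fourierInv_eq_fourier_neg]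
  have e3 : ∀ x, 𝓕 (𝓕⁻ ψ : 𝓢(ℝ, ℂ)) x = ψ x := fun x => by
    rw [FourierTransform.fourier_fourierInv_eq]
  rw [integral_schwartz_mul_fourier]
  calc ∫ x, 𝓕 ψ x * b x = ∫ x, 𝓕 ψ x * a (-x) :=
        integral_congr_ae (by filter_upwards [h] with x hx; rw [hx])
    _ = ∫ x, 𝓕 ψ (-x) * a x := by
        rw [← integral_neg_eq_self]; simp
    _ = ∫ x, 𝓕⁻ ψ x * a x := by simp only [e]
    _ = ∫ x, ψ (-x) * (𝓕 a : Lp ℂ 2 (volume : Measure ℝ)) x := by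
        have : (𝓕⁻ ψ : 𝓢(ℝ, ℂ)) = 𝓕 (𝓕⁻ (𝓕⁻ ψ : 𝓢(ℝ, ℂ)) : 𝓢(ℝ, ℂ)) :=
          (FourierTransform.fourier_fourierInv_eq _).symm
        rw [this, ← integral_schwartz_mul_fourier]
        refine integral_congr_ae (.of_forall fun x => ?_)
        simp only
        congr 1
        rw [SchwartzMap.fourierInv_coe, Real.fourierInv_eq_fourier_neg, ← SchwartzMap.fourier_coe,
          e3]
    _ = _ := by rw [← integral_neg_eq_self]; simp

/-! ### Poisson means at Lebesgue points. -/

/-- The Poisson kernel is dominated by a dyadic sum of indicators of balls. -/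
theorem ofReal_poisson_le_tsum {ε : ℝ} (hε : 0 < ε) (x t : ℝ) :
    ENNReal.ofReal (ε / ((x - t) ^ 2 + ε ^ 2)) ≤
      ∑' k : ℕ, (Metric.closedBall x (2 ^ k * ε)).indicator
        (fun _ => ENNReal.ofReal (4 / ε * (1 / 4) ^ k)) t := by
  have hex : ∃ k : ℕ, |x - t| ≤ 2 ^ k * ε := by
    obtain ⟨k, hk⟩ := pow_unbounded_of_one_lt (|x - t| / ε) (one_lt_two (α := ℝ))
    exact ⟨k, by rw [div_lt_iff₀ hε] at hk; exact hk.le⟩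
  classical
  -- For the least k, if k ≥ 1 then |x - t| > 2^(k-1) ε, so the kernel is at most ε / (4^(k-1) ε²) =
  -- (4/ε) 4^(-k); for k = 0 the trivial bound 1/ε suffices.
  have hk := Nat.find_spec hex
  set k := Nat.find hex with hkdef
  refine le_trans ?_ (ENNReal.le_tsum k)
  rw [indicator_of_mem (by rw [Metric.mem_closedBall, Real.dist_eq, abs_sub_comm]; exact hk)]
  refine ENNReal.ofReal_le_ofReal ?_
  rcases Nat.eq_zero_or_pos k with h0 | h0
  · rw [h0, pow_zero, mul_one, div_le_div_iff₀ (by positivity) hε]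
    nlinarith [sq_nonneg (x - t), sq_nonneg ε]
  · have h1 : ¬ |x - t| ≤ 2 ^ (k - 1) * ε := Nat.find_min hex (by omega)
    push Not at h1
    have h2 : (2 ^ (k - 1) * ε) ^ 2 ≤ (x - t) ^ 2 := by
      rw [← sq_abs (x - t)]
      exact pow_le_pow_left₀ (by positivity) h1.le 2
    obtain ⟨m, hm⟩ : ∃ m, k = m + 1 := ⟨k - 1, by omega⟩
    rw [hm] at h2 ⊢
    simp only [Nat.add_sub_cancel] at h2
    have e : (4 : ℝ) / ε * (1 / 4) ^ (m + 1) = 1 / (ε * (2 ^ m) ^ 2) := by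
      rw [pow_succ, one_div_pow, show (4 : ℝ) = 2 ^ 2 by norm_num, ← pow_mul, ← pow_mul,
        mul_comm m 2]
      field_simp
    rw [e, div_le_div_iff₀ (by positivity) (by positivity)]
    nlinarith [sq_nonneg (x - t), sq_nonneg ε, mul_pow (2 ^ m : ℝ) ε 2]

/-- The weight 4^(-k)/ε splits into 1/(2^k ε), which normalises the integral over the ball of that
radius, and the summable factor 2^(-k). -/
theorem lintegral_mul_poisson_le {g : ℝ → ℝ} (hg0 : ∀ t, 0 ≤ g t) (hg : LocallyIntegrable g)
    (x : ℝ) {ε : ℝ} (hε : 0 < ε) :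
    ∫⁻ t, ENNReal.ofReal (g t * (ε / ((x - t) ^ 2 + ε ^ 2))) ≤
      ∑' k : ℕ, ENNReal.ofReal
        (4 * (1 / 2) ^ k * ((∫ t in Metric.closedBall x (2 ^ k * ε), g t) / (2 ^ k * ε))) := by
  have hm : AEMeasurable g := hg.aestronglyMeasurable.aemeasurable
  calc ∫⁻ t, ENNReal.ofReal (g t * (ε / ((x - t) ^ 2 + ε ^ 2)))
      ≤ ∫⁻ t, ∑' k : ℕ, (Metric.closedBall x (2 ^ k * ε)).indicator
          (fun t => ENNReal.ofReal (4 / ε * (1 / 4) ^ k) * ENNReal.ofReal (g t)) t := by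
        refine lintegral_mono fun t => ?_
        rw [ENNReal.ofReal_mul (hg0 t)]
        calc _ ≤ ENNReal.ofReal (g t) * ∑' k : ℕ, (Metric.closedBall x (2 ^ k * ε)).indicator
                (fun _ => ENNReal.ofReal (4 / ε * (1 / 4) ^ k)) t := by
              gcongr; exact ofReal_poisson_le_tsum hε x t
          _ = _ := by
              rw [← ENNReal.tsum_mul_left]
              congr 1 with k
              by_cases ht : t ∈ Metric.closedBall x (2 ^ k * ε)
              · rw [indicator_of_mem ht, indicator_of_mem ht, mul_comm]
              · simp only [indicator_of_notMem ht, mul_zero]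
    _ = ∑' k : ℕ, ∫⁻ t, (Metric.closedBall x (2 ^ k * ε)).indicator
          (fun t => ENNReal.ofReal (4 / ε * (1 / 4) ^ k) * ENNReal.ofReal (g t)) t := by
        refine lintegral_tsum fun k => AEMeasurable.indicator ?_ measurableSet_closedBall
        exact hm.ennreal_ofReal.const_mul _
    _ = _ := by
        congr 1 with k
        rw [lintegral_indicator measurableSet_closedBall, lintegral_const_mul' _ _ (by simp),
          ← ofReal_integral_eq_lintegral_ofReal
            (hg.integrableOn_isCompact (isCompact_closedBall _ _)) (.of_forall hg0),
          ← ENNReal.ofReal_mul (by positivity)]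
        congr 1
        have : (1 / 4 : ℝ) ^ k = (1 / 2) ^ k * (1 / 2) ^ k := by
          rw [← mul_pow]; norm_num
        rw [this, one_div_pow]
        field_simp

/-- If the averages of `g ≥ 0` over balls around `x` are bounded and tend to zero with the radius,
then so do its Poisson means. -/
theorem tendsto_integral_mul_poisson {g : ℝ → ℝ} (hg0 : ∀ t, 0 ≤ g t) (hg : LocallyIntegrable g)
    (x : ℝ) {M : ℝ} (hM : ∀ r, 0 < r → (∫ t in Metric.closedBall x r, g t) / r ≤ M)
    (h0 : Tendsto (fun r => (∫ t in Metric.closedBall x r, g t) / r) (𝓝[>] 0) (𝓝 0)) :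
    (∀ ε, 0 < ε → Integrable fun t => g t * (ε / ((x - t) ^ 2 + ε ^ 2))) ∧
    Tendsto (fun ε => ∫ t, g t * (ε / ((x - t) ^ 2 + ε ^ 2))) (𝓝[>] 0) (𝓝 0) := by
  set A : ℝ → ℝ := fun r => (∫ t in Metric.closedBall x r, g t) / r with hA
  have hA0 : ∀ r, 0 < r → 0 ≤ A r := fun r hr => by
    have : 0 ≤ ∫ t in Metric.closedBall x r, g t := integral_nonneg fun t => hg0 t
    simp only [hA]; positivity
  have hgeo : Summable fun k : ℕ => 4 * (1 / 2 : ℝ) ^ k * M :=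
    ((summable_geometric_two).mul_left 4).mul_right M
  have hs : ∀ ε, 0 < ε → Summable fun k : ℕ => 4 * (1 / 2 : ℝ) ^ k * A (2 ^ k * ε) := by
    intro ε hε
    refine Summable.of_nonneg_of_le (fun k => ?_) (fun k => ?_) hgeo
    · have := hA0 (2 ^ k * ε) (by positivity)
      positivity
    · gcongr; exact hM _ (by positivity)
  have hle : ∀ ε, 0 < ε → ∫⁻ t, ENNReal.ofReal (g t * (ε / ((x - t) ^ 2 + ε ^ 2))) ≤
      ENNReal.ofReal (∑' k : ℕ, 4 * (1 / 2 : ℝ) ^ k * A (2 ^ k * ε)) := by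
    intro ε hε
    rw [ENNReal.ofReal_tsum_of_nonneg _ (hs ε hε)]
    · exact lintegral_mul_poisson_le hg0 hg x hε
    · intro k
      have := hA0 (2 ^ k * ε) (by positivity)
      positivity
  have hmeas : ∀ ε, 0 < ε →
      AEStronglyMeasurable (fun t => g t * (ε / ((x - t) ^ 2 + ε ^ 2))) volume := by
    intro ε hε
    refine hg.aestronglyMeasurable.mul (Continuous.aestronglyMeasurable ?_)
    exact continuous_const.div (by fun_prop) fun t => by positivity
  have hnn : ∀ ε, 0 < ε → ∀ t, 0 ≤ g t * (ε / ((x - t) ^ 2 + ε ^ 2)) := fun ε hε t => by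
    have := hg0 t
    positivity
  refine ⟨fun ε hε => ⟨hmeas ε hε, ?_⟩, ?_⟩
  · rw [hasFiniteIntegral_iff_ofReal (.of_forall (hnn ε hε))]
    exact (hle ε hε).trans_lt ENNReal.ofReal_lt_top
  · have hT : Tendsto (fun ε => ∑' k : ℕ, 4 * (1 / 2 : ℝ) ^ k * A (2 ^ k * ε)) (𝓝[>] 0)
        (𝓝 (∑' _ : ℕ, (0 : ℝ))) := by
      -- Each average tends to 0 with ε, and the bound `M` on averages at every radius supplies a
      -- geometric majorant.
      refine tendsto_tsum_of_dominated_convergence hgeo (fun k => ?_) ?_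
      · have : Tendsto (fun ε : ℝ => 2 ^ k * ε) (𝓝[>] 0) (𝓝[>] 0) := by
          refine tendsto_nhdsWithin_iff.2 ⟨?_, ?_⟩
          · refine Tendsto.mono_left ?_ nhdsWithin_le_nhds
            have : Continuous fun ε : ℝ => 2 ^ k * ε := by fun_prop
            simpa using this.tendsto 0
          · filter_upwards [self_mem_nhdsWithin] with ε hε
            have : (0 : ℝ) < ε := hε
            simp only [mem_Ioi]
            positivity
        simpa using (h0.comp this).const_mul (4 * (1 / 2 : ℝ) ^ k)
      · filter_upwards [self_mem_nhdsWithin] with ε hε k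
        have hε' : (0 : ℝ) < ε := hε
        have := hA0 (2 ^ k * ε) (by positivity)
        rw [Real.norm_of_nonneg (by positivity)]
        gcongr
        exact hM _ (by positivity)
    rw [tsum_zero] at hT
    refine squeeze_zero' ?_ ?_ hT
    · filter_upwards [self_mem_nhdsWithin] with ε hε using integral_nonneg (hnn ε hε)
    · filter_upwards [self_mem_nhdsWithin] with ε hε
      rw [integral_eq_lintegral_of_nonneg_ae (.of_forall (hnn ε hε)) (hmeas ε hε)]
      refine ENNReal.toReal_le_of_le_ofReal (tsum_nonneg fun k => ?_) (hle ε hε)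
      have hε' : (0 : ℝ) < ε := hε
      have := hA0 (2 ^ k * ε) (by positivity)
      positivity

/-- Poisson means of `‖a - a x‖` tend to zero at almost every `x`, for square integrable `a`. -/
theorem ae_tendsto_integral_norm_sub_mul_poisson {a : ℝ → ℂ} (ha : MemLp a 2) :
    ∀ᵐ x, (∀ ε, 0 < ε → Integrable fun t => ‖a t - a x‖ * (ε / ((x - t) ^ 2 + ε ^ 2))) ∧
      Tendsto (fun ε => ∫ t, ‖a t - a x‖ * (ε / ((x - t) ^ 2 + ε ^ 2))) (𝓝[>] 0) (𝓝 0) := by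
  have hl : LocallyIntegrable a := ha.locallyIntegrable (by norm_num)
  have hsq : Integrable fun t => ‖a t‖ ^ 2 := ha.integrable_norm_pow (by norm_num)
  filter_upwards [IsUnifLocDoublingMeasure.ae_tendsto_average_norm_sub
    (μ := (volume : Measure ℝ)) hl 1] with x hx
  have hg : LocallyIntegrable fun t => ‖a t - a x‖ := fun y => by
    obtain ⟨s, hs, h⟩ := hl.sub (locallyIntegrable_const (a x)) y
    exact ⟨s, hs, h.norm⟩
  have hI : ∀ r : ℝ, IntegrableOn (fun t => ‖a t - a x‖) (Metric.closedBall x r) := fun r =>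
    hg.integrableOn_isCompact (isCompact_closedBall _ _)
  have hc : ∀ r : ℝ, Integrable (fun _ : ℝ => 1 + ‖a x‖)
      (volume.restrict (Metric.closedBall x r)) := fun r =>
    (locallyIntegrable_const _).integrableOn_isCompact (isCompact_closedBall _ _)
  have h0 : Tendsto (fun r => (∫ t in Metric.closedBall x r, ‖a t - a x‖) / r) (𝓝[>] 0)
      (𝓝 0) := by
    have h1 := (hx (fun _ => x) (fun r => r) tendsto_id (by
      filter_upwards [self_mem_nhdsWithin] with r hr
      exact Metric.mem_closedBall_self (by simpa using (le_of_lt hr)))).const_mul 2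
    rw [mul_zero] at h1
    refine h1.congr' ?_
    filter_upwards [self_mem_nhdsWithin] with r hr
    have hr' : (0 : ℝ) < r := hr
    rw [setAverage_eq, Measure.real, Real.volume_closedBall,
      ENNReal.toReal_ofReal (by positivity), smul_eq_mul]
    field_simp
  -- The averages must be bounded at all radii. Below δ the Lebesgue point property does it; from δ
  -- on, ‖a t‖ ≤ 1 + ‖a t‖² bounds the integral by a multiple of r plus the squared L² norm.
  obtain ⟨δ, hδ, hδ1⟩ : ∃ δ > 0, ∀ r, 0 < r → r < δ →
      (∫ t in Metric.closedBall x r, ‖a t - a x‖) / r ≤ 1 := by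
    have := h0.eventually (ge_mem_nhds (zero_lt_one (α := ℝ)))
    rw [eventually_nhdsWithin_iff, Metric.eventually_nhds_iff] at this
    obtain ⟨δ, hδ, h⟩ := this
    exact ⟨δ, hδ, fun r hr hrδ => h (by rw [Real.dist_eq, sub_zero, abs_of_pos hr]; exact hrδ) hr⟩
  have hS : 0 ≤ ∫ t, ‖a t‖ ^ 2 := integral_nonneg fun t => by positivity
  refine tendsto_integral_mul_poisson (fun t => norm_nonneg _) hg x
    (M := 1 + (2 * (1 + ‖a x‖) + (∫ t, ‖a t‖ ^ 2) / δ)) (fun r hr => ?_) h0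
  rcases lt_or_ge r δ with h | h
  · have : 0 ≤ 2 * (1 + ‖a x‖) + (∫ t, ‖a t‖ ^ 2) / δ := by positivity
    linarith [hδ1 r hr h]
  · have h2 : ∫ t in Metric.closedBall x r, ‖a t - a x‖ ≤
        2 * r * (1 + ‖a x‖) + ∫ t, ‖a t‖ ^ 2 := by
      calc ∫ t in Metric.closedBall x r, ‖a t - a x‖
          ≤ ∫ t in Metric.closedBall x r, ((1 + ‖a x‖) + ‖a t‖ ^ 2) := by
            refine integral_mono (hI r) ?_ fun t => ?_
            · exact (hc r).add hsq.integrableOn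
            · have := norm_sub_le (a t) (a x)
              simp only
              nlinarith [sq_nonneg (‖a t‖ - 1), norm_nonneg (a t)]
        _ = 2 * r * (1 + ‖a x‖) + ∫ t in Metric.closedBall x r, ‖a t‖ ^ 2 := by
            rw [integral_add (hc r) hsq.integrableOn, setIntegral_const,
              Measure.real, Real.volume_closedBall, ENNReal.toReal_ofReal (by positivity),
              smul_eq_mul]
        _ ≤ _ := by
            refine add_le_add le_rfl ?_
            exact setIntegral_le_integral hsq (.of_forall fun t => sq_nonneg _)
    have h3 : (∫ t, ‖a t‖ ^ 2) / r ≤ (∫ t, ‖a t‖ ^ 2) / δ := by gcongr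
    calc _ ≤ (2 * r * (1 + ‖a x‖) + ∫ t, ‖a t‖ ^ 2) / r := by gcongr
      _ = 2 * (1 + ‖a x‖) + (∫ t, ‖a t‖ ^ 2) / r := by field_simp
      _ ≤ _ := by linarith

/-! ### Poisson and conjugate Poisson kernels as Fourier transforms, and conjugate functions. -/

/-- The Poisson kernel `ε / (w² + ε²)`. -/
noncomputable def poissonKer (ε w : ℝ) : ℝ := ε / (w ^ 2 + ε ^ 2)

/-- The conjugate Poisson kernel `w / (w² + ε²)`. -/
noncomputable def conjPoissonKer (ε w : ℝ) : ℝ := w / (w ^ 2 + ε ^ 2)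

/-- The two-sided exponential `e^{-2πε|ξ| + 2πixξ}`, weighted by `p` on the right and `q` on
the left half-line. -/
noncomputable def twoSidedExp (p q : ℂ) (ε x ξ : ℝ) : ℂ :=
  (if 0 < ξ then p else q) * Complex.exp ((-2 * Real.pi * ε * |ξ| : ℝ) + (2 * Real.pi * x * ξ : ℝ) *
    Complex.I)

theorem norm_twoSidedExp_le (p q : ℂ) (ε x ξ : ℝ) :
    ‖twoSidedExp p q ε x ξ‖ ≤ (‖p‖ + ‖q‖) * Real.exp (-(2 * Real.pi * ε) * |ξ|) := by
  rw [twoSidedExp, norm_mul, Complex.norm_exp]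
  simp only [Complex.add_re, Complex.ofReal_re, Complex.re_ofReal_mul, Complex.I_re, mul_zero,
    add_zero]
  rw [show -2 * Real.pi * ε * |ξ| = -(2 * Real.pi * ε) * |ξ| by ring]
  gcongr
  split_ifs
  · linarith [norm_nonneg q]
  · linarith [norm_nonneg p]

theorem measurable_twoSidedExp (p q : ℂ) (ε x : ℝ) : Measurable (twoSidedExp p q ε x) := by
  refine Measurable.mul ?_ ?_
  · exact Measurable.ite measurableSet_Ioi measurable_const measurable_const
  · exact Continuous.measurable (by fun_prop)

theorem integrable_exp_neg_mul_abs {c : ℝ} (hc : 0 < c) :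
    Integrable fun ξ : ℝ => Real.exp (-c * |ξ|) := by
  have h1 : IntegrableOn (fun ξ : ℝ => Real.exp (-c * |ξ|)) (Ioi 0) := by
    refine (integrableOn_exp_mul_Ioi (neg_lt_zero.2 hc) 0).congr_fun (fun ξ hξ => ?_)
      measurableSet_Ioi
    simp only [abs_of_pos (show (0 : ℝ) < ξ from hξ)]
  have h2 : IntegrableOn (fun ξ : ℝ => Real.exp (-c * |ξ|)) (Iic 0) := by
    refine (integrableOn_exp_mul_Iic hc 0).congr_fun (fun ξ hξ => ?_)
      measurableSet_Iic
    simp only [abs_of_nonpos (show ξ ≤ (0 : ℝ) from hξ)]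
    ring_nf
  rw [← integrableOn_univ, ← Iic_union_Ioi (a := (0 : ℝ))]
  exact h2.union h1

theorem integrable_twoSidedExp (p q : ℂ) {ε : ℝ} (hε : 0 < ε) (x : ℝ) :
    Integrable (twoSidedExp p q ε x) :=
  ((integrable_exp_neg_mul_abs (c := 2 * Real.pi * ε) (by positivity)).const_mul _).mono'
    (measurable_twoSidedExp p q ε x).aestronglyMeasurable
    (.of_forall (norm_twoSidedExp_le p q ε x))

theorem memLp_twoSidedExp (p q : ℂ) {ε : ℝ} (hε : 0 < ε) (x : ℝ) :
    MemLp (twoSidedExp p q ε x) 2 := by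
  rw [memLp_two_iff_integrable_sq_norm (measurable_twoSidedExp p q ε x).aestronglyMeasurable]
  refine ((integrable_exp_neg_mul_abs (c := 2 * (2 * Real.pi * ε)) (by positivity)).const_mul
    ((‖p‖ + ‖q‖) ^ 2)).mono' ?_ (.of_forall fun ξ => ?_)
  · exact ((measurable_twoSidedExp p q ε x).norm.pow_const 2).aestronglyMeasurable
  · rw [Real.norm_of_nonneg (by positivity)]
    refine (pow_le_pow_left₀ (norm_nonneg _) (norm_twoSidedExp_le p q ε x ξ) 2).trans_eq ?_
    rw [mul_pow, ← Real.exp_nat_mul]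
    push_cast
    ring_nf

/-- Equal weights yield the Poisson kernel and opposite weights the conjugate one, so multiplying
frequencies by their sign exchanges the two kernels. -/
theorem fourier_twoSidedExp (p q : ℂ) {ε : ℝ} (hε : 0 < ε) (x t : ℝ) :
    𝓕 (twoSidedExp p q ε x) t =
      (p / (ε - (x - t) * Complex.I) + q / (ε + (x - t) * Complex.I)) / (2 * Real.pi) := by
  have hπ := Real.pi_pos
  set z : ℂ := 2 * Real.pi * (ε + (x - t) * Complex.I) with hz
  set z' : ℂ := -(2 * Real.pi * (ε - (x - t) * Complex.I)) with hz'
  have hzre : z.re = 2 * Real.pi * ε := by simp [hz]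
  have hzre' : z'.re = -(2 * Real.pi * ε) := by simp [hz']
  have e1 : ∀ ξ ∈ Ioi (0 : ℝ), Complex.exp (↑(-2 * Real.pi * ξ * t) * Complex.I) •
      twoSidedExp p q ε x ξ = p * Complex.exp (z' * ξ) := by
    intro ξ hξ
    have hξ' : 0 < ξ := hξ
    rw [twoSidedExp, if_pos hξ', abs_of_pos hξ', smul_eq_mul, mul_left_comm, ← Complex.exp_add]
    congr 2
    rw [hz']; push_cast; ring
  have e2 : ∀ ξ ∈ Iic (0 : ℝ), Complex.exp (↑(-2 * Real.pi * ξ * t) * Complex.I) •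
      twoSidedExp p q ε x ξ = q * Complex.exp (z * ξ) := by
    intro ξ hξ
    have hξ' : ξ ≤ 0 := hξ
    rw [twoSidedExp, if_neg hξ'.not_gt, abs_of_nonpos hξ', smul_eq_mul, mul_left_comm,
      ← Complex.exp_add]
    congr 2
    rw [hz]; push_cast; ring
  have h1 : z'.re < 0 := by rw [hzre']; have := mul_pos (mul_pos two_pos hπ) hε; linarith
  have h2 : 0 < z.re := by rw [hzre]; positivity
  have hi1 := integrableOn_exp_mul_complex_Ioi h1 0
  have hi2 := integrableOn_exp_mul_complex_Iic h2 0
  rw [Real.fourier_real_eq_integral_exp_smul]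
  rw [← intervalIntegral.integral_Iic_add_Ioi (b := 0)
    (IntegrableOn.congr_fun (hi2.const_mul q) (fun ξ hξ => (e2 ξ hξ).symm) measurableSet_Iic)
    (IntegrableOn.congr_fun (hi1.const_mul p) (fun ξ hξ => (e1 ξ hξ).symm) measurableSet_Ioi),
    setIntegral_congr_fun measurableSet_Ioi e1, setIntegral_congr_fun measurableSet_Iic e2,
    integral_const_mul, integral_const_mul, integral_exp_mul_complex_Ioi h1,
    integral_exp_mul_complex_Iic h2]
  have hd1 : (ε - (x - t) * Complex.I : ℂ) ≠ 0 := fun h => by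
    have := congrArg Complex.re h; simp at this; linarith
  have hd2 : (ε + (x - t) * Complex.I : ℂ) ≠ 0 := fun h => by
    have := congrArg Complex.re h; simp at this; linarith
  have hπ' : (Real.pi : ℂ) ≠ 0 := by exact_mod_cast hπ.ne'
  simp only [Complex.ofReal_zero, mul_zero, Complex.exp_zero]
  rw [hz, hz']
  field_simp
  ring

theorem ofReal_add_mul_I_mul_sub (ε w : ℝ) :
    ((ε : ℂ) - w * Complex.I) * (ε + w * Complex.I) = ((w ^ 2 + ε ^ 2 : ℝ) : ℂ) := by
  push_cast
  linear_combination (-(w : ℂ) ^ 2) * Complex.I_sq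

theorem fourier_twoSidedExp_one_one {ε : ℝ} (hε : 0 < ε) (x t : ℝ) :
    𝓕 (twoSidedExp 1 1 ε x) t = (poissonKer ε (x - t) : ℂ) / Real.pi := by
  rw [fourier_twoSidedExp _ _ hε, poissonKer]
  have h := ofReal_add_mul_I_mul_sub ε (x - t)
  have h0 : (((x - t) ^ 2 + ε ^ 2 : ℝ) : ℂ) ≠ 0 := by
    exact_mod_cast (by positivity : (x - t) ^ 2 + ε ^ 2 ≠ 0)
  rw [Complex.ofReal_div, ← h]
  rw [← h] at h0
  have hπ' : (Real.pi : ℂ) ≠ 0 := by exact_mod_cast Real.pi_pos.ne'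
  push_cast at h0 ⊢
  have h1 := left_ne_zero_of_mul h0
  have h2 := right_ne_zero_of_mul h0
  field_simp
  ring

theorem fourier_twoSidedExp_one_neg_one {ε : ℝ} (hε : 0 < ε) (x t : ℝ) :
    𝓕 (twoSidedExp 1 (-1) ε x) t = Complex.I * (conjPoissonKer ε (x - t) : ℂ) / Real.pi := by
  rw [fourier_twoSidedExp _ _ hε, conjPoissonKer]
  have h := ofReal_add_mul_I_mul_sub ε (x - t)
  have h0 : (((x - t) ^ 2 + ε ^ 2 : ℝ) : ℂ) ≠ 0 := by
    exact_mod_cast (by positivity : (x - t) ^ 2 + ε ^ 2 ≠ 0)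
  rw [Complex.ofReal_div, ← h]
  rw [← h] at h0
  have hπ' : (Real.pi : ℂ) ≠ 0 := by exact_mod_cast Real.pi_pos.ne'
  push_cast at h0 ⊢
  have h1 := left_ne_zero_of_mul h0
  have h2 := right_ne_zero_of_mul h0
  field_simp
  ring

/-- The Hilbert transform on `L²`, in terms of Poisson integrals: each square integrable `a` has a
conjugate function `b`. -/
theorem exists_conjugate_function (a : Lp ℂ 2 (volume : Measure ℝ)) :
    ∃ b : Lp ℂ 2 (volume : Measure ℝ), ∀ ε : ℝ, 0 < ε → ∀ x : ℝ,
      ∫ t, a t * (conjPoissonKer ε (x - t) : ℂ) = ∫ t, b t * (poissonKer ε (x - t) : ℂ) ∧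
      ∫ t, b t * (conjPoissonKer ε (x - t) : ℂ) = -∫ t, a t * (poissonKer ε (x - t) : ℂ) := by
  set A : Lp ℂ 2 (volume : Measure ℝ) := 𝓕 a with hA
  -- The multiplier of the conjugate function is -i sgn ξ. The value -1 at ξ = 0 agrees with
  -- `twoSidedExp` and makes s² = 1 hold without exception.
  set s : ℝ → ℂ := fun ξ => if 0 < ξ then 1 else -1 with hs
  have hsm : Measurable s := Measurable.ite measurableSet_Ioi measurable_const measurable_const
  have hB : MemLp (fun ξ => -Complex.I * s ξ * A ξ) 2 := by
    refine (Lp.memLp A).of_le ((hsm.const_mul _).aestronglyMeasurable.mul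
      (Lp.aestronglyMeasurable A)) (.of_forall fun ξ => ?_)
    have : ‖s ξ‖ = 1 := by simp only [hs]; split_ifs <;> simp
    simp [this]
  refine ⟨𝓕⁻ (hB.toLp _), fun ε hε x => ?_⟩
  set b : Lp ℂ 2 (volume : Measure ℝ) := 𝓕⁻ (hB.toLp _) with hb
  have hFb : (𝓕 b : Lp ℂ 2 (volume : Measure ℝ)) =ᵐ[volume] fun ξ => -Complex.I * s ξ * A ξ := by
    rw [hb, FourierTransform.fourier_fourierInv_eq]
    exact hB.coeFn_toLp
  have hπ' : (Real.pi : ℂ) ≠ 0 := by exact_mod_cast Real.pi_pos.ne'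
  have key : ∀ (c : Lp ℂ 2 (volume : Measure ℝ)),
      ∫ t, c t * (poissonKer ε (x - t) : ℂ) =
        Real.pi * ∫ ξ, (𝓕 c : Lp ℂ 2 (volume : Measure ℝ)) ξ * twoSidedExp 1 1 ε x ξ ∧
      ∫ t, c t * (conjPoissonKer ε (x - t) : ℂ) =
        -Complex.I * Real.pi *
          ∫ ξ, (𝓕 c : Lp ℂ 2 (volume : Measure ℝ)) ξ * twoSidedExp 1 (-1) ε x ξ := by
    intro c
    rw [← integral_mul_fourierIntegral_eq c (integrable_twoSidedExp 1 1 hε x)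
      (memLp_twoSidedExp 1 1 hε x), ← integral_mul_fourierIntegral_eq c
      (integrable_twoSidedExp 1 (-1) hε x) (memLp_twoSidedExp 1 (-1) hε x),
      ← integral_const_mul, ← integral_const_mul]
    constructor
    · congr 1 with t
      rw [fourier_twoSidedExp_one_one hε]
      field_simp
    · congr 1 with t
      rw [fourier_twoSidedExp_one_neg_one hε]
      field_simp
      linear_combination (c t * (conjPoissonKer ε (x - t) : ℂ)) * Complex.I_sq
  have hst : ∀ ξ, twoSidedExp 1 (-1) ε x ξ = s ξ * twoSidedExp 1 1 ε x ξ := by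
    intro ξ
    simp only [twoSidedExp, hs, ite_self, one_mul]
  have hss : ∀ ξ, s ξ * s ξ = 1 := by
    intro ξ; simp only [hs]; split_ifs <;> simp
  have h1 : ∫ ξ, (𝓕 b : Lp ℂ 2 (volume : Measure ℝ)) ξ * twoSidedExp 1 1 ε x ξ =
      -Complex.I * ∫ ξ, A ξ * twoSidedExp 1 (-1) ε x ξ := by
    rw [← integral_const_mul]
    refine integral_congr_ae ?_
    filter_upwards [hFb] with ξ hξ
    rw [hξ, hst]; ring
  have h2 : ∫ ξ, (𝓕 b : Lp ℂ 2 (volume : Measure ℝ)) ξ * twoSidedExp 1 (-1) ε x ξ =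
      -Complex.I * ∫ ξ, A ξ * twoSidedExp 1 1 ε x ξ := by
    rw [← integral_const_mul]
    refine integral_congr_ae ?_
    filter_upwards [hFb] with ξ hξ
    rw [hξ, hst]; linear_combination (-Complex.I * A ξ * twoSidedExp 1 1 ε x ξ) * hss ξ
  refine ⟨?_, ?_⟩
  · rw [(key a).2, (key b).1, h1]; ring
  · rw [(key b).2, (key a).1, h2]
    linear_combination (Real.pi * ∫ ξ, A ξ * twoSidedExp 1 1 ε x ξ) * Complex.I_sq

/-! ### Kernel estimates and almost everywhere convergence of truncated Hilbert integrals. -/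

theorem poissonKer_pos {ε : ℝ} (hε : 0 < ε) (w : ℝ) : 0 < poissonKer ε w := by
  rw [poissonKer]; positivity

theorem poissonKer_eq {ε : ℝ} (hε : 0 < ε) (w : ℝ) :
    poissonKer ε w = ε⁻¹ * (1 + (w / ε) ^ 2)⁻¹ := by
  rw [poissonKer]; field_simp; ring

theorem continuous_poissonKer {ε : ℝ} (hε : 0 < ε) : Continuous (poissonKer ε) :=
  continuous_const.div (by fun_prop) fun w => by positivity

theorem continuous_conjPoissonKer {ε : ℝ} (hε : 0 < ε) : Continuous (conjPoissonKer ε) :=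
  continuous_id.div (by fun_prop) fun w => by positivity

theorem integrable_poissonKer {ε : ℝ} (hε : 0 < ε) : Integrable (poissonKer ε) := by
  simp only [funext (poissonKer_eq hε)]
  exact (integrable_inv_one_add_sq.comp_div hε.ne').const_mul _

theorem integral_poissonKer {ε : ℝ} (hε : 0 < ε) : ∫ w, poissonKer ε w = Real.pi := by
  simp only [poissonKer_eq hε]
  rw [integral_const_mul, Measure.integral_comp_div (fun w => (1 + w ^ 2)⁻¹),
    integral_univ_inv_one_add_sq, abs_of_pos hε, smul_eq_mul]
  field_simp

/-- The truncated kernel `1 / w` for `|w| > ε`. -/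
noncomputable def truncKer (ε w : ℝ) : ℝ := if ε < |w| then 1 / w else 0

theorem measurable_truncKer (ε : ℝ) : Measurable (truncKer ε) :=
  Measurable.ite (measurableSet_lt measurable_const measurable_norm)
    (measurable_const.div measurable_id) measurable_const

/-- For |w| > ε the difference is -ε²/(w(w² + ε²)), and ε²/|w| < ε; for |w| ≤ ε only w/(w² + ε²) is
present. This reduces truncation to Poisson means. -/
theorem abs_conjPoissonKer_sub_truncKer_le {ε : ℝ} (hε : 0 < ε) (w : ℝ) :
    |conjPoissonKer ε w - truncKer ε w| ≤ poissonKer ε w := by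
  rw [conjPoissonKer, truncKer, poissonKer]
  split_ifs with h
  · have hw : w ≠ 0 := fun h0 => by rw [h0, abs_zero] at h; linarith
    have : w / (w ^ 2 + ε ^ 2) - 1 / w = -(ε ^ 2 / (w * (w ^ 2 + ε ^ 2))) := by
      field_simp; ring
    rw [this, abs_neg, abs_div, abs_mul, abs_of_pos (by positivity : 0 < w ^ 2 + ε ^ 2),
      abs_of_pos (by positivity : 0 < ε ^ 2), div_le_div_iff₀ (by positivity) (by positivity)]
    have : 0 < ε * (w ^ 2 + ε ^ 2) := by positivity
    nlinarith
  · push Not at h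
    rw [sub_zero, abs_div, abs_of_pos (by positivity : 0 < w ^ 2 + ε ^ 2)]
    gcongr

theorem truncKer_neg (ε w : ℝ) : truncKer ε (-w) = -truncKer ε w := by
  rw [truncKer, truncKer, abs_neg]
  split_ifs
  · rw [div_neg]
  · simp

theorem conjPoissonKer_neg (ε w : ℝ) : conjPoissonKer ε (-w) = -conjPoissonKer ε w := by
  rw [conjPoissonKer, conjPoissonKer, neg_sq, neg_div]

theorem integral_eq_zero_of_odd {k : ℝ → ℝ} (hk : ∀ w, k (-w) = -k w) : ∫ w, k w = 0 := by
  have h := integral_neg_eq_self k volume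
  simp only [hk, integral_neg] at h
  linarith

/-- A measurable kernel with `k² ≤ C ε / (w² + ε²)` is square integrable. -/
theorem memLp_two_of_sq_le_poissonKer {k : ℝ → ℝ} (hk : Measurable k) {ε C : ℝ} (hε : 0 < ε)
    (h : ∀ w, k w ^ 2 ≤ C * poissonKer ε w) (x : ℝ) :
    MemLp (fun t => (k (x - t) : ℂ)) 2 := by
  have hm : Measurable fun t => (k (x - t) : ℂ) :=
    Complex.measurable_ofReal.comp (hk.comp (measurable_const.sub measurable_id))
  rw [memLp_two_iff_integrable_sq_norm hm.aestronglyMeasurable]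
  refine (((integrable_poissonKer hε).const_mul C).comp_sub_left x).mono'
    (hm.norm.pow_const 2).aestronglyMeasurable (.of_forall fun t => ?_)
  rw [Real.norm_of_nonneg (by positivity), Complex.norm_real, Real.norm_eq_abs, sq_abs]
  exact h _

theorem memLp_conjPoissonKer {ε : ℝ} (hε : 0 < ε) (x : ℝ) :
    MemLp (fun t => (conjPoissonKer ε (x - t) : ℂ)) 2 := by
  refine memLp_two_of_sq_le_poissonKer (continuous_conjPoissonKer hε).measurable (C := ε⁻¹) hε
    (fun w => ?_) x
  rw [conjPoissonKer, poissonKer, div_pow, inv_mul_eq_div, div_div, mul_comm (w ^ 2 + ε ^ 2) ε,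
    div_le_div_iff₀ (by positivity) (by positivity)]
  have : 0 ≤ ε ^ 3 * (w ^ 2 + ε ^ 2) := by positivity
  nlinarith

theorem memLp_poissonKer {ε : ℝ} (hε : 0 < ε) (x : ℝ) :
    MemLp (fun t => (poissonKer ε (x - t) : ℂ)) 2 := by
  refine memLp_two_of_sq_le_poissonKer (continuous_poissonKer hε).measurable (C := ε⁻¹) hε
    (fun w => ?_) x
  rw [sq]
  refine mul_le_mul_of_nonneg_right ?_ (poissonKer_pos hε w).le
  rw [poissonKer, inv_eq_one_div, div_le_div_iff₀ (by positivity) hε]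
  nlinarith [sq_nonneg w]

theorem memLp_truncKer {ε : ℝ} (hε : 0 < ε) (x : ℝ) :
    MemLp (fun t => (truncKer ε (x - t) : ℂ)) 2 := by
  refine memLp_two_of_sq_le_poissonKer (measurable_truncKer ε) (C := 2 / ε) hε (fun w => ?_) x
  rw [truncKer, poissonKer]
  split_ifs with h
  · have h2 : ε ^ 2 ≤ w ^ 2 := by
      rw [← sq_abs w]; exact pow_le_pow_left₀ hε.le h.le 2
    have hw : w ≠ 0 := fun h0 => by rw [h0, abs_zero] at h; linarith
    rw [show 2 / ε * (ε / (w ^ 2 + ε ^ 2)) = 2 / (w ^ 2 + ε ^ 2) by field_simp, div_pow, one_pow,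
      div_le_div_iff₀ (by positivity) (by positivity)]
    linarith
  · simp only [ne_eq, OfNat.ofNat_ne_zero, not_false_eq_true, zero_pow]
    positivity

theorem integrable_mul_of_memLp_two {a k : ℝ → ℂ} {μ : Measure ℝ} (ha : MemLp a 2 μ)
    (hk : MemLp k 2 μ) : Integrable (fun t => a t * k t) μ :=
  ha.integrable_mul hk

/-- Poisson integrals of a square integrable function converge almost everywhere. -/
theorem ae_tendsto_poisson_integral {b : ℝ → ℂ} (hb : MemLp b 2) :
    ∀ᵐ x, Tendsto (fun ε => ∫ t, b t * (poissonKer ε (x - t) : ℂ)) (𝓝[>] 0)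
      (𝓝 (Real.pi * b x)) := by
  filter_upwards [ae_tendsto_integral_norm_sub_mul_poisson hb] with x ⟨hxi, hx⟩
  rw [tendsto_iff_norm_sub_tendsto_zero]
  refine squeeze_zero' (.of_forall fun _ => norm_nonneg _) ?_ hx
  filter_upwards [self_mem_nhdsWithin] with ε hε
  have hε' : (0 : ℝ) < ε := hε
  have hP : Integrable fun t => (poissonKer ε (x - t) : ℂ) :=
    ((integrable_poissonKer hε').comp_sub_left x).ofReal
  have e : ∫ t, b x * (poissonKer ε (x - t) : ℂ) = Real.pi * b x := by
    rw [integral_const_mul, integral_complex_ofReal,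
      integral_sub_left_eq_self (poissonKer ε) volume x, integral_poissonKer hε', mul_comm]
  rw [← e, ← integral_sub (integrable_mul_of_memLp_two hb (memLp_poissonKer hε' x))
    (hP.const_mul _)]
  refine norm_integral_le_of_norm_le (hxi ε hε') (.of_forall fun t => ?_)
  rw [← sub_mul, norm_mul, Complex.norm_real, Real.norm_of_nonneg (poissonKer_pos hε' _).le]
  rfl

/-- The truncated Hilbert integrals and the conjugate Poisson integrals of a square integrable
function differ by a null family almost everywhere. -/
theorem ae_tendsto_conjPoisson_sub_trunc {a : ℝ → ℂ} (ha : MemLp a 2) :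
    ∀ᵐ x, Tendsto (fun ε => (∫ t, a t * (conjPoissonKer ε (x - t) : ℂ)) -
      ∫ t, a t * (truncKer ε (x - t) : ℂ)) (𝓝[>] 0) (𝓝 0) := by
  filter_upwards [ae_tendsto_integral_norm_sub_mul_poisson ha] with x ⟨hxi, hx⟩
  rw [tendsto_zero_iff_norm_tendsto_zero]
  refine squeeze_zero' (.of_forall fun _ => norm_nonneg _) ?_ hx
  filter_upwards [self_mem_nhdsWithin] with ε hε
  have hε' : (0 : ℝ) < ε := hε
  set D : ℝ → ℝ := fun w => conjPoissonKer ε w - truncKer ε w with hD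
  have hDm : Measurable D := (continuous_conjPoissonKer hε').measurable.sub (measurable_truncKer ε)
  have hDi : Integrable D := (integrable_poissonKer hε').mono' hDm.aestronglyMeasurable
    (.of_forall (abs_conjPoissonKer_sub_truncKer_le hε'))
  have hDi' : Integrable fun t => (D (x - t) : ℂ) := (hDi.comp_sub_left x).ofReal
  -- The difference kernel is odd and integrable, so it annihilates constants and `a t` may be
  -- replaced by `a t - a x`.
  have e : ∫ t, a x * (D (x - t) : ℂ) = 0 := by
    rw [integral_const_mul, integral_complex_ofReal, integral_sub_left_eq_self D volume x,
      integral_eq_zero_of_odd (fun w => by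
        simp only [hD, conjPoissonKer_neg, truncKer_neg]; ring), Complex.ofReal_zero, mul_zero]
  have h1 := integrable_mul_of_memLp_two ha (memLp_conjPoissonKer hε' x)
  have h2 := integrable_mul_of_memLp_two ha (memLp_truncKer hε' x)
  have e2 : (∫ t, a t * (conjPoissonKer ε (x - t) : ℂ)) - ∫ t, a t * (truncKer ε (x - t) : ℂ) =
      ∫ t, (a t - a x) * (D (x - t) : ℂ) := by
    have h12 : Integrable fun t => a t * (conjPoissonKer ε (x - t) : ℂ) -
        a t * (truncKer ε (x - t) : ℂ) := h1.sub h2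
    rw [← integral_sub h1 h2, ← sub_zero (integral volume _), ← e, ← integral_sub h12
      (hDi'.const_mul _)]
    congr 1 with t
    simp only [hD]
    push_cast
    ring
  rw [e2]
  refine norm_integral_le_of_norm_le (hxi ε hε') (.of_forall fun t => ?_)
  rw [norm_mul, Complex.norm_real, Real.norm_eq_abs]
  exact mul_le_mul_of_nonneg_left (abs_conjPoissonKer_sub_truncKer_le hε' _) (norm_nonneg _)

/-- If `b` is conjugate to `a`, the truncated Hilbert integrals of `a` converge to `π b` almost
everywhere. -/
theorem ae_tendsto_truncated_hilbert {a b : ℝ → ℂ} (ha : MemLp a 2) (hb : MemLp b 2)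
    (h : ∀ ε : ℝ, 0 < ε → ∀ x : ℝ,
      ∫ t, a t * (conjPoissonKer ε (x - t) : ℂ) = ∫ t, b t * (poissonKer ε (x - t) : ℂ)) :
    ∀ᵐ x, Tendsto (fun ε => ∫ t, a t * (truncKer ε (x - t) : ℂ)) (𝓝[>] 0)
      (𝓝 (Real.pi * b x)) := by
  filter_upwards [ae_tendsto_conjPoisson_sub_trunc ha, ae_tendsto_poisson_integral hb]
    with x hx1 hx2
  have := hx2.sub hx1
  rw [sub_zero] at this
  refine this.congr' ?_
  filter_upwards [self_mem_nhdsWithin] with ε hε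
  rw [h ε hε x]
  ring

/-! ### The cosine on the critical line and the kernel with reciprocal-cosine transform. -/

/-- `cos (π s / 2)` on the critical line, at `s = 1/2 + 2πiξ`. -/
noncomputable def critCos (ξ : ℝ) : ℂ :=
  Complex.cos ((Real.pi : ℂ) * critPt (2 * Real.pi * ξ) / 2)

theorem critPt_neg (τ : ℝ) : critPt (-τ) = 1 - critPt τ := by
  rw [critPt, critPt]; push_cast; ring

/-- Reflection of ξ is s ↦ 1 - s, which turns the cosine into the sine; one function therefore
serves both systems of conditions. -/
theorem critCos_neg (ξ : ℝ) :
    critCos (-ξ) = Complex.sin ((Real.pi : ℂ) * critPt (2 * Real.pi * ξ) / 2) := by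
  rw [critCos, mul_neg, critPt_neg, ← Complex.cos_pi_div_two_sub]
  congr 1
  ring

theorem continuous_critCos : Continuous critCos := by
  unfold critCos critPt
  fun_prop

theorem one_add_sq_div_four_le_cosh (y : ℝ) : 1 + y ^ 2 / 4 ≤ Real.cosh y := by
  rw [← Real.cosh_abs, Real.cosh_eq, ← sq_abs]
  have h1 := Real.quadratic_le_exp_of_nonneg (abs_nonneg y)
  have h2 := Real.add_one_le_exp (-|y|)
  linarith

/-- The argument is π/4 + iπ²ξ, so the real part is (√2/2) cosh(π²ξ). Quadratic growth is enough to
rule out zeros and to put the reciprocal in L¹ ∩ L². -/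
theorem one_add_sq_le_norm_critCos (ξ : ℝ) : (1 + ξ ^ 2) / 4 ≤ ‖critCos ξ‖ := by
  have hre : (critCos ξ).re = √2 / 2 * Real.cosh (Real.pi ^ 2 * ξ) := by
    have : (Real.pi : ℂ) * critPt (2 * Real.pi * ξ) / 2 =
        ((Real.pi / 4 : ℝ) : ℂ) + ((Real.pi ^ 2 * ξ : ℝ) : ℂ) * Complex.I := by
      rw [critPt]; push_cast; ring
    rw [critCos, this, Complex.cos_add_mul_I, ← Complex.ofReal_cos, ← Complex.ofReal_cosh,
      ← Complex.ofReal_sin, ← Complex.ofReal_sinh, Real.cos_pi_div_four, ← Complex.ofReal_mul,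
      ← Complex.ofReal_mul, Complex.sub_re, Complex.ofReal_re, Complex.re_ofReal_mul, Complex.I_re,
      mul_zero, sub_zero]
  refine le_trans ?_ (Complex.re_le_norm _)
  rw [hre]
  have h1 : (1 + ξ ^ 2) / 2 ≤ Real.cosh (Real.pi ^ 2 * ξ) := by
    have h := one_add_sq_div_four_le_cosh (Real.pi ^ 2 * ξ)
    have h2 : 2 * ξ ^ 2 ≤ (Real.pi ^ 2 * ξ) ^ 2 := by
      have : 2 ≤ Real.pi ^ 2 := by nlinarith [Real.pi_gt_three]
      rw [mul_pow]
      exact mul_le_mul_of_nonneg_right (by nlinarith) (sq_nonneg _)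
    linarith
  have h3 : (1 : ℝ) ≤ √2 := Real.one_le_sqrt.2 (by norm_num)
  nlinarith [Real.cosh_pos (Real.pi ^ 2 * ξ)]

theorem critCos_ne_zero (ξ : ℝ) : critCos ξ ≠ 0 := by
  intro h
  have := one_add_sq_le_norm_critCos ξ
  rw [h, norm_zero] at this
  nlinarith [sq_nonneg ξ]

theorem norm_inv_critCos_le (ξ : ℝ) : ‖(critCos ξ)⁻¹‖ ≤ 4 * (1 + ξ ^ 2)⁻¹ := by
  rw [norm_inv, inv_le_comm₀ (norm_pos_iff.2 (critCos_ne_zero ξ)) (by positivity)]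
  refine le_trans (le_of_eq ?_) (one_add_sq_le_norm_critCos ξ)
  rw [mul_inv, inv_inv]; ring

theorem continuous_inv_critCos : Continuous fun ξ => (critCos ξ)⁻¹ :=
  continuous_critCos.inv₀ critCos_ne_zero

theorem integrable_inv_critCos : Integrable fun ξ => (critCos ξ)⁻¹ :=
  (integrable_inv_one_add_sq.const_mul 4).mono' continuous_inv_critCos.aestronglyMeasurable
    (.of_forall norm_inv_critCos_le)

theorem memLp_inv_critCos : MemLp (fun ξ => (critCos ξ)⁻¹) 2 := by
  rw [memLp_two_iff_integrable_sq_norm continuous_inv_critCos.aestronglyMeasurable]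
  refine (integrable_inv_one_add_sq.const_mul 16).mono'
    (continuous_inv_critCos.norm.pow 2).aestronglyMeasurable (.of_forall fun ξ => ?_)
  rw [Real.norm_of_nonneg (by positivity)]
  refine (pow_le_pow_left₀ (norm_nonneg _) (norm_inv_critCos_le ξ) 2).trans ?_
  have h : (1 + ξ ^ 2)⁻¹ ≤ 1 := inv_le_one_of_one_le₀ (by linarith [sq_nonneg ξ])
  have h0 : 0 ≤ (1 + ξ ^ 2)⁻¹ := by positivity
  nlinarith

/-- The kernel `t / (1 + t²)` in the logarithmic variable, `t = e^{-w}`, with the factor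
`e^{-w/2}` of the critical line. -/
noncomputable def logKer (w : ℝ) : ℝ := Real.exp (-w / 2) / (Real.exp w + Real.exp (-w))

theorem continuous_logKer : Continuous logKer :=
  Continuous.div (by fun_prop) (by fun_prop) fun w => by positivity

theorem integrable_logKer : Integrable logKer := by
  refine (integrable_exp_neg_mul_abs (c := 1 / 2) (by norm_num)).mono'
    continuous_logKer.aestronglyMeasurable (.of_forall fun w => ?_)
  have hp := Real.exp_pos w
  have hn := Real.exp_pos (-w)
  rw [logKer, Real.norm_of_nonneg (by positivity), div_le_iff₀ (by positivity), mul_add,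
    ← Real.exp_add, ← Real.exp_add]
  rcases le_total 0 w with h | h
  · rw [abs_of_nonneg h]
    have : Real.exp (-w / 2) ≤ Real.exp (-(1 / 2) * w + w) := Real.exp_le_exp.2 (by linarith)
    linarith [Real.exp_pos (-(1 / 2) * w + -w)]
  · rw [abs_of_nonpos h]
    have : Real.exp (-w / 2) ≤ Real.exp (-(1 / 2) * -w + -w) := Real.exp_le_exp.2 (by linarith)
    linarith [Real.exp_pos (-(1 / 2) * -w + w)]

/-- Euler's reflection integral in the logarithmic variable. -/
theorem integral_cexp_div_exp_add_exp_neg {p : ℂ} (h0 : 0 < p.re) (h1 : p.re < 1) :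
    ∫ w : ℝ, Complex.exp (w * (1 - 2 * p)) / (Real.exp w + Real.exp (-w) : ℝ) =
      Real.pi / (2 * Complex.sin (Real.pi * p)) := by
  have hB : Complex.betaIntegral p (1 - p) = Real.pi / Complex.sin (Real.pi * p) := by
    have := Complex.Gamma_mul_Gamma_eq_betaIntegral (s := p) (t := 1 - p) h0 (by simpa using h1)
    rw [add_sub_cancel, Complex.Gamma_one, one_mul, Complex.Gamma_mul_Gamma_one_sub] at this
    exact this.symm
  -- The substitution y = 1/(1 + e^{2w}) carries the line onto (0, 1) and turns B(p, 1 - p) = π /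
  -- sin(πp) into twice the integral.
  set φ : ℝ → ℝ := fun w => (1 + Real.exp (2 * w))⁻¹ with hφ
  set φ' : ℝ → ℝ := fun w => -(2 * Real.exp (2 * w)) / (1 + Real.exp (2 * w)) ^ 2 with hφ'
  have hpos : ∀ w : ℝ, 0 < 1 + Real.exp (2 * w) := fun w => by positivity
  have hd : ∀ w ∈ univ, HasDerivWithinAt φ (φ' w) univ w := by
    intro w _
    have h := ((Real.hasDerivAt_exp (2 * w)).comp w ((hasDerivAt_id w).const_mul 2)).const_add 1
    refine (HasDerivAt.congr_deriv (h.inv (hpos w).ne') ?_).hasDerivWithinAt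
    simp only [hφ', mul_one, Function.comp_apply]
    ring
  have hinj : InjOn φ univ := by
    intro x _ y _ h
    have h' := inv_injective h
    have := Real.exp_injective (add_left_cancel h')
    linarith
  have himg : φ '' univ = Ioo 0 1 := by
    ext y
    constructor
    · rintro ⟨w, -, rfl⟩
      refine ⟨inv_pos.2 (hpos w), inv_lt_one_of_one_lt₀ ?_⟩
      linarith [Real.exp_pos (2 * w)]
    · rintro ⟨hy0, hy1⟩
      refine ⟨Real.log (y⁻¹ - 1) / 2, mem_univ _, ?_⟩
      have : 0 < y⁻¹ - 1 := by
        have := (one_lt_inv₀ hy0).2 hy1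
        linarith
      simp only [hφ]
      rw [mul_div_cancel₀ _ (two_ne_zero), Real.exp_log this]
      simp
  have hI : Complex.betaIntegral p (1 - p) =
      2 * ∫ w : ℝ, Complex.exp (w * (1 - 2 * p)) / (Real.exp w + Real.exp (-w) : ℝ) := by
    rw [Complex.betaIntegral, intervalIntegral.integral_of_le zero_le_one,
      integral_Ioc_eq_integral_Ioo, ← himg,
      integral_image_eq_integral_abs_deriv_smul MeasurableSet.univ hd hinj, setIntegral_univ,
      ← integral_const_mul]
    congr 1 with w
    set E := Real.exp (2 * w) with hE
    have hEpos : 0 < E := Real.exp_pos _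
    have hlog1 : (φ w : ℂ) = Complex.exp (-(Real.log (1 + E) : ℂ)) := by
      rw [← Complex.ofReal_neg, ← Complex.ofReal_exp, Real.exp_neg, Real.exp_log (hpos w)]
    have hsub : (1 : ℂ) - φ w = Complex.exp ((2 * w - Real.log (1 + E) : ℝ) : ℂ) := by
      rw [← Complex.ofReal_exp, Real.exp_sub, Real.exp_log (hpos w), ← hE]
      simp only [hφ]
      rw [← hE, ← Complex.ofReal_one, ← Complex.ofReal_sub]
      congr 1
      field_simp
      ring
    have hlogc : ∀ (r : ℝ) (z : ℂ), Complex.exp (r : ℂ) ^ z = Complex.exp (r * z) := by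
      intro r z
      rw [Complex.cpow_def_of_ne_zero (Complex.exp_ne_zero _), ← Complex.ofReal_exp,
        ← Complex.ofReal_log (Real.exp_pos r).le, Real.log_exp]
    have hphi' : ((|φ' w| : ℝ) : ℂ) = 2 * Complex.exp ((2 * w - 2 * Real.log (1 + E) : ℝ) : ℂ) := by
      have : |φ' w| = 2 * Real.exp (2 * w - 2 * Real.log (1 + E)) := by
        rw [Real.exp_sub, two_mul (Real.log (1 + E)), Real.exp_add, Real.exp_log (hpos w), ← hE]
        simp only [hφ']
        rw [neg_div, abs_neg, abs_of_pos (by positivity), ← hE]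
        ring
      rw [this]; push_cast; ring
    have hden : ((Real.exp w + Real.exp (-w) : ℝ) : ℂ) =
        Complex.exp ((Real.log (1 + E) - w : ℝ) : ℂ) := by
      rw [← Complex.ofReal_exp, Real.exp_sub, Real.exp_log (hpos w)]
      congr 1
      rw [add_div, ← Real.exp_sub, one_div, ← Real.exp_neg]
      ring_nf
    rw [Complex.real_smul, hphi', hsub, hlog1, ← Complex.ofReal_neg, hlogc, hlogc, hden,
      mul_assoc, ← Complex.exp_add, ← Complex.exp_add, ← Complex.exp_sub]
    congr 2
    push_cast
    ring
  have : (∫ w : ℝ, Complex.exp (w * (1 - 2 * p)) / (Real.exp w + Real.exp (-w) : ℝ)) =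
      Real.pi / Complex.sin (Real.pi * p) / 2 := by
    rw [← hB, hI]; ring
  rw [this, div_div, mul_comm (Complex.sin _)]

/-- Euler's integral at p = (1 + s)/2: there 1 - 2p = -s, sin(πp) = cos(πs/2), and Re p = 3/4 lies
in the strip of convergence. -/
theorem fourier_logKer (ξ : ℝ) :
    𝓕 (fun w => (logKer w : ℂ)) ξ = Real.pi / 2 * (critCos ξ)⁻¹ := by
  set p : ℂ := (1 + critPt (2 * Real.pi * ξ)) / 2 with hp
  have hre : p.re = 3 / 4 := by
    have : p = ((3 / 4 : ℝ) : ℂ) + ((Real.pi * ξ : ℝ) : ℂ) * Complex.I := by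
      rw [hp, critPt]; push_cast; ring
    rw [this, Complex.add_re, Complex.ofReal_re, Complex.re_ofReal_mul, Complex.I_re]
    ring
  have h := integral_cexp_div_exp_add_exp_neg (p := p) (by rw [hre]; norm_num)
    (by rw [hre]; norm_num)
  have hs : Complex.sin (Real.pi * p) = critCos ξ := by
    rw [critCos, ← Complex.sin_add_pi_div_two]
    congr 1
    rw [hp]; ring
  rw [hs] at h
  rw [Real.fourier_real_eq_integral_exp_smul, show (Real.pi : ℂ) / 2 * (critCos ξ)⁻¹ =
    Real.pi / (2 * critCos ξ) by rw [← div_div]; rfl, ← h]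
  congr 1 with w
  rw [logKer, Complex.ofReal_div, smul_eq_mul, Complex.ofReal_exp, mul_div_assoc',
    ← Complex.exp_add]
  congr 2
  rw [hp, critPt]; push_cast; ring

theorem fourierInv_inv_critCos (w : ℝ) :
    𝓕⁻ (fun ξ => (Real.pi / 2 : ℂ) * (critCos ξ)⁻¹) w = logKer w := by
  have hc : Continuous fun w => (logKer w : ℂ) := Complex.continuous_ofReal.comp continuous_logKer
  have hF : 𝓕 (fun w => (logKer w : ℂ)) = fun ξ => (Real.pi / 2 : ℂ) * (critCos ξ)⁻¹ :=
    funext fourier_logKer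
  have := hc.fourierInv_fourier_eq integrable_logKer.ofReal
    (by rw [hF]; exact integrable_inv_critCos.const_mul _)
  rw [← hF, this]

/-- Correlation identities with `logKer` become multiplier identities on the Fourier side. -/
theorem fourier_mul_critCos_ae_eq {α β : Lp ℂ 2 (volume : Measure ℝ)}
    (h : ∀ v : ℝ, ∫ u, α u * (logKer (u - v) : ℂ) = ∫ u, β u * (logKer (v - u) : ℂ)) :
    ∀ᵐ ξ, (𝓕 α : Lp ℂ 2 (volume : Measure ℝ)) ξ * critCos ξ =
      (𝓕 β : Lp ℂ 2 (volume : Measure ℝ)) ξ * critCos (-ξ) := by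
  set K : ℝ → ℂ := fun ξ => (Real.pi / 2 : ℂ) * (critCos ξ)⁻¹ with hK
  have hKm : MemLp K 2 := memLp_inv_critCos.const_mul _
  have hKi : Integrable K := integrable_inv_critCos.const_mul _
  have hKm' : MemLp (fun ξ => K (-ξ)) 2 :=
    hKm.comp_measurePreserving (Measure.measurePreserving_neg volume)
  have hKi' : Integrable (fun ξ => K (-ξ)) := hKi.comp_neg
  set e : ℝ → ℝ → ℂ := fun v ξ => Complex.exp ((2 * Real.pi * ξ * v : ℝ) * Complex.I) with he
  have hec : ∀ v, Continuous (e v) := fun v => by simp only [he]; fun_prop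
  have hen : ∀ v ξ, ‖e v ξ‖ = 1 := fun v ξ => Complex.norm_exp_ofReal_mul_I _
  have hmem : ∀ (v : ℝ) (q : ℝ → ℂ), Integrable q → MemLp q 2 →
      Integrable (fun ξ => e v ξ * q ξ) ∧ MemLp (fun ξ => e v ξ * q ξ) 2 := by
    intro v q h1 h2
    have hm : AEStronglyMeasurable (fun ξ => e v ξ * q ξ) volume :=
      (hec v).aestronglyMeasurable.mul h1.aestronglyMeasurable
    refine ⟨h1.norm.mono' hm (.of_forall fun ξ => ?_), h2.of_le hm (.of_forall fun ξ => ?_)⟩ <;>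
    rw [norm_mul, hen, one_mul]
  have hF2 : ∀ v u, 𝓕 (fun ξ => e v ξ * K ξ) u = logKer (v - u) := by
    intro v u
    rw [← fourierInv_inv_critCos, Real.fourier_real_eq_integral_exp_smul, Real.fourierInv_eq']
    congr 1 with ξ
    simp only [he, hK, smul_eq_mul]
    rw [← mul_assoc, ← Complex.exp_add]
    congr 2
    simp
    ring
  have hF1 : ∀ v u, 𝓕 (fun ξ => e v ξ * K (-ξ)) u = logKer (u - v) := by
    intro v u
    rw [← fourierInv_inv_critCos, Real.fourier_real_eq_integral_exp_smul, Real.fourierInv_eq',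
      ← integral_neg_eq_self]
    congr 1 with ξ
    simp only [he, hK, smul_eq_mul, neg_neg]
    rw [← mul_assoc, ← Complex.exp_add]
    congr 2
    simp
    ring
  set A : Lp ℂ 2 (volume : Measure ℝ) := 𝓕 α with hA
  set B : Lp ℂ 2 (volume : Measure ℝ) := 𝓕 β with hB
  have hi1 : Integrable fun ξ => A ξ * K (-ξ) := integrable_mul_of_memLp_two (Lp.memLp A) hKm'
  have hi2 : Integrable fun ξ => B ξ * K ξ := integrable_mul_of_memLp_two (Lp.memLp B) hKm
  -- Modulating by `e v` translates the kernel, so the two correlations are the inverse Fourier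
  -- integrals at v of A(ξ)K(-ξ) and B(ξ)K(ξ). Both products are integrable, and equality for every
  -- v forces them to coincide.
  have hz := ae_eq_zero_of_fourierInv_eq_zero (hi1.sub hi2) fun v => by
    have h1 := hmem v _ hKi' hKm'
    have h2 := hmem v _ hKi hKm
    have hv : ∫ u, α u * 𝓕 (fun ξ => e v ξ * K (-ξ)) u = ∫ u, β u * 𝓕 (fun ξ => e v ξ * K ξ) u := by
      simp only [hF1, hF2]
      exact h v
    rw [integral_mul_fourierIntegral_eq α h1.1 h1.2, integral_mul_fourierIntegral_eq β h2.1 h2.2,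
      ← sub_eq_zero, ← integral_sub (integrable_mul_of_memLp_two (Lp.memLp _) h1.2)
        (integrable_mul_of_memLp_two (Lp.memLp _) h2.2)] at hv
    rw [← hv, Real.fourierInv_eq']
    congr 1 with ξ
    simp only [he, smul_eq_mul, Pi.sub_apply]
    rw [show (inner ℝ ξ v : ℝ) = ξ * v by simp [mul_comm], mul_assoc (2 * Real.pi) ξ v]
    ring
  filter_upwards [hz] with ξ hξ
  have h1 := critCos_ne_zero ξ
  have h2 := critCos_ne_zero (-ξ)
  have hπ' : (Real.pi : ℂ) ≠ 0 := by exact_mod_cast Real.pi_pos.ne'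
  simp only [Pi.sub_apply, hK, Pi.zero_apply] at hξ
  field_simp at hξ
  rw [mul_zero] at hξ
  linear_combination (mul_eq_zero.1 hξ).resolve_left hπ'

/-! ### The logarithmic change of variable. -/

theorem hasDerivWithinAt_exp_neg (u : ℝ) (s : Set ℝ) :
    HasDerivWithinAt (fun u : ℝ => Real.exp (-u)) (-Real.exp (-u)) s u := by
  have := (Real.hasDerivAt_exp (-u)).comp u (hasDerivAt_neg u)
  rw [mul_neg_one] at this
  exact this.hasDerivWithinAt

theorem image_exp_neg_univ : (fun u : ℝ => Real.exp (-u)) '' univ = Ioi 0 := by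
  ext x
  simp only [image_univ, mem_range, mem_Ioi]
  exact ⟨fun ⟨u, hu⟩ => hu ▸ Real.exp_pos _, fun hx => ⟨-Real.log x, by
    rw [neg_neg, Real.exp_log hx]⟩⟩

theorem exp_neg_injective : Function.Injective fun u : ℝ => Real.exp (-u) :=
  Real.exp_injective.comp neg_injective

theorem lintegral_Ioi_eq_lintegral_exp_neg (g : ℝ → ℝ≥0∞) :
    ∫⁻ t in Ioi 0, g t = ∫⁻ u, ENNReal.ofReal (Real.exp (-u)) * g (Real.exp (-u)) := by
  rw [← image_exp_neg_univ, lintegral_image_eq_lintegral_abs_deriv_mul MeasurableSet.univ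
    (fun u _ => hasDerivWithinAt_exp_neg u univ) exp_neg_injective.injOn, setLIntegral_univ]
  simp

theorem integral_Ioi_eq_integral_exp_neg (g : ℝ → ℂ) :
    ∫ t in Ioi 0, g t = ∫ u, (Real.exp (-u) : ℂ) * g (Real.exp (-u)) := by
  rw [← image_exp_neg_univ, integral_image_eq_integral_abs_deriv_smul MeasurableSet.univ
    (fun u _ => hasDerivWithinAt_exp_neg u univ) exp_neg_injective.injOn, setIntegral_univ]
  simp

/-- `P` need not be measurable, so null sets are transported as images under the differentiable maps
e^{-u} and -log x. -/
theorem ae_Ioi_iff_ae_exp_neg {P : ℝ → Prop} :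
    (∀ᵐ x ∂volume.restrict (Ioi (0 : ℝ)), P x) ↔ ∀ᵐ u : ℝ, P (Real.exp (-u)) := by
  rw [ae_restrict_iff' measurableSet_Ioi, ae_iff, ae_iff]
  have e1 : {x : ℝ | ¬(x ∈ Ioi 0 → P x)} =
      (fun u : ℝ => Real.exp (-u)) '' {u | ¬P (Real.exp (-u))} := by
    ext x
    simp only [mem_Ioi, Classical.not_imp, mem_ofPred_eq, mem_image]
    constructor
    · rintro ⟨hx, hP⟩
      exact ⟨-Real.log x, by rwa [neg_neg, Real.exp_log hx], by rw [neg_neg, Real.exp_log hx]⟩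
    · rintro ⟨u, hu, rfl⟩
      exact ⟨Real.exp_pos _, hu⟩
  have e2 : {u : ℝ | ¬P (Real.exp (-u))} =
      (fun x => -Real.log x) '' {x : ℝ | ¬(x ∈ Ioi 0 → P x)} := by
    rw [e1, image_image]
    simp
  constructor
  · intro h
    rw [e2]
    refine addHaar_image_eq_zero_of_differentiableOn_of_addHaar_eq_zero volume ?_ h
    intro x hx
    simp only [mem_Ioi, Classical.not_imp, mem_ofPred_eq] at hx
    exact (Real.differentiableAt_log hx.1.ne').neg.differentiableWithinAt
  · intro h
    rw [e1]
    exact addHaar_image_eq_zero_of_differentiableOn_of_addHaar_eq_zero volume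
      (fun u _ => (hasDerivWithinAt_exp_neg u _).differentiableWithinAt) h

theorem ae_Ioi_one_div_iff {P : ℝ → Prop} :
    (∀ᵐ x ∂volume.restrict (Ioi (0 : ℝ)), P (1 / x)) ↔
      ∀ᵐ x ∂volume.restrict (Ioi (0 : ℝ)), P x := by
  rw [ae_Ioi_iff_ae_exp_neg, ae_Ioi_iff_ae_exp_neg]
  have h : ∀ {Q : ℝ → Prop}, (∀ᵐ u : ℝ, Q u) → ∀ᵐ u : ℝ, Q (-u) := fun hQ =>
    (Measure.measurePreserving_neg (volume : Measure ℝ)).quasiMeasurePreserving.ae hQ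
  constructor <;> intro hP
  · filter_upwards [h hP] with u hu
    rwa [neg_neg, one_div, ← Real.exp_neg] at hu
  · filter_upwards [h hP] with u hu
    rwa [one_div, ← Real.exp_neg]

/-- The function `f` in the logarithmic variable `t = e^{-u}`, normalised so as to preserve
the `L²` norm. -/
noncomputable def logPull (f : ℝ → ℂ) (u : ℝ) : ℂ := (Real.exp (-u / 2) : ℂ) * f (Real.exp (-u))

theorem quasiMeasurePreserving_exp_neg :
    Measure.QuasiMeasurePreserving (fun u : ℝ => Real.exp (-u)) volume
      (volume.restrict (Ioi 0)) := by
  have hm : Measurable fun u : ℝ => Real.exp (-u) := by fun_prop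
  refine ⟨hm, Measure.AbsolutelyContinuous.mk fun s hs h => ?_⟩
  rw [Measure.map_apply hm hs]
  have : ∀ᵐ x ∂volume.restrict (Ioi (0 : ℝ)), x ∉ s := measure_eq_zero_iff_ae_notMem.1 h
  exact measure_eq_zero_iff_ae_notMem.2 (ae_Ioi_iff_ae_exp_neg.1 this)

theorem eLpNorm_logPull (f : ℝ → ℂ) :
    eLpNorm (logPull f) 2 volume = eLpNorm f 2 (volume.restrict (Ioi 0)) := by
  rw [eLpNorm_eq_lintegral_rpow_enorm_toReal (by norm_num) (by norm_num),
    eLpNorm_eq_lintegral_rpow_enorm_toReal (by norm_num) (by norm_num),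
    lintegral_Ioi_eq_lintegral_exp_neg]
  congr 2 with u
  rw [logPull, enorm_mul, ENNReal.mul_rpow_of_nonneg _ _ (by norm_num)]
  congr 1
  rw [← ofReal_norm, Complex.norm_real, Real.norm_of_nonneg (Real.exp_pos _).le,
    ENNReal.ofReal_rpow_of_pos (Real.exp_pos _), ← Real.exp_mul]
  congr 2
  norm_num

theorem memLp_logPull {f : ℝ → ℂ} (hf : MemL2HalfLine f) : MemLp (logPull f) 2 := by
  refine ⟨?_, ?_⟩
  · refine Continuous.aestronglyMeasurable (by fun_prop) |>.mul ?_
    exact hf.1.comp_quasiMeasurePreserving quasiMeasurePreserving_exp_neg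
  · rw [eLpNorm_logPull]; exact hf.2

/-! ### The Mellin transform and its mean square inversion as an L² Fourier transform. -/

/-- The line is parametrised by τ while Fourier frequencies are ξ = τ/(2π); the dilation changes L²
norms by a constant, so it affects neither membership nor limits. -/
theorem eLpNorm_comp_two_pi_mul (p : ℝ → ℂ) :
    eLpNorm p 2 volume = ENNReal.ofReal (2 * Real.pi) ^ (1 / 2 : ℝ) *
      eLpNorm (fun ξ => p (2 * Real.pi * ξ)) 2 volume := by
  have hπ : 0 < 2 * Real.pi := by positivity
  have hemb : MeasurableEmbedding fun ξ : ℝ => 2 * Real.pi * ξ :=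
    (Homeomorph.mulLeft₀ (2 * Real.pi) hπ.ne').measurableEmbedding
  have h := Real.smul_map_volume_mul_left hπ.ne'
  rw [abs_of_pos hπ] at h
  conv_lhs => rw [← h]
  rw [eLpNorm_smul_measure_of_ne_top (by norm_num), hemb.eLpNorm_map_measure]
  simp [Function.comp_def]

theorem memLp_comp_two_pi_mul_iff {p : ℝ → ℂ} :
    MemLp (fun ξ => p (2 * Real.pi * ξ)) 2 ↔ MemLp p 2 := by
  have hπ : 0 < 2 * Real.pi := by positivity
  have hq : ∀ c : ℝ, c ≠ 0 → Measure.QuasiMeasurePreserving (fun ξ : ℝ => c * ξ) volume volume := by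
    intro c hc
    refine ⟨by fun_prop, ?_⟩
    rw [Real.map_volume_mul_left hc]
    exact Measure.smul_absolutelyContinuous
  have hc : ENNReal.ofReal (2 * Real.pi) ^ (1 / 2 : ℝ) ≠ 0 :=
    (ENNReal.rpow_pos (ENNReal.ofReal_pos.2 hπ) ENNReal.ofReal_ne_top).ne'
  have hc' : ENNReal.ofReal (2 * Real.pi) ^ (1 / 2 : ℝ) ≠ ∞ :=
    ENNReal.rpow_ne_top_of_nonneg (by norm_num) ENNReal.ofReal_ne_top
  constructor
  · intro h
    refine ⟨?_, ?_⟩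
    · have := h.1.comp_quasiMeasurePreserving (hq (2 * Real.pi)⁻¹ (inv_ne_zero hπ.ne'))
      refine this.congr (.of_forall fun x => ?_)
      simp only [Function.comp_apply]
      rw [mul_inv_cancel_left₀ hπ.ne']
    · rw [eLpNorm_comp_two_pi_mul]
      exact ENNReal.mul_lt_top hc'.lt_top h.2
  · intro h
    refine ⟨h.1.comp_quasiMeasurePreserving (hq _ hπ.ne'), ?_⟩
    have := h.2
    rw [eLpNorm_comp_two_pi_mul] at this
    exact lt_of_not_ge fun h' => by
      rw [top_le_iff.1 h', ENNReal.mul_top hc] at this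
      exact lt_irrefl _ this

theorem tendsto_eLpNorm_comp_two_pi_mul_iff {p : ℝ → ℝ → ℂ} {l : Filter ℝ} :
    Tendsto (fun N => eLpNorm (fun ξ => p N (2 * Real.pi * ξ)) 2 volume) l (𝓝 0) ↔
      Tendsto (fun N => eLpNorm (p N) 2 volume) l (𝓝 0) := by
  have hπ : 0 < 2 * Real.pi := by positivity
  have hc : ENNReal.ofReal (2 * Real.pi) ^ (1 / 2 : ℝ) ≠ 0 :=
    (ENNReal.rpow_pos (ENNReal.ofReal_pos.2 hπ) ENNReal.ofReal_ne_top).ne'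
  have hc' : ENNReal.ofReal (2 * Real.pi) ^ (1 / 2 : ℝ) ≠ ∞ :=
    ENNReal.rpow_ne_top_of_nonneg (by norm_num) ENNReal.ofReal_ne_top
  set c := ENNReal.ofReal (2 * Real.pi) ^ (1 / 2 : ℝ)
  constructor
  · intro h
    have := ENNReal.Tendsto.const_mul h (Or.inr hc')
    rw [mul_zero] at this
    exact this.congr fun N => (eLpNorm_comp_two_pi_mul (p N)).symm
  · intro h
    have := ENNReal.Tendsto.const_mul (a := c⁻¹) h (Or.inr (ENNReal.inv_ne_top.2 hc))
    rw [mul_zero] at this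
    refine this.congr fun N => ?_
    rw [eLpNorm_comp_two_pi_mul (p N), ← mul_assoc, ENNReal.inv_mul_cancel hc hc', one_mul]

theorem tendsto_eLpNorm_indicator_sub {g : ℝ → ℂ} (hg : MemLp g 2) :
    Tendsto (fun N : ℝ => eLpNorm ((Icc (-N) N).indicator g - g) 2 volume) atTop (𝓝 0) := by
  have hsq : ∫⁻ u, ‖g u‖ₑ ^ (2 : ℝ) ≠ ∞ := by
    have := lintegral_rpow_enorm_lt_top_of_eLpNorm_lt_top (by norm_num) (by norm_num) hg.2
    simpa using this.ne
  have h : Tendsto (fun N : ℝ => ∫⁻ u, ‖((Icc (-N) N).indicator g - g) u‖ₑ ^ (2 : ℝ)) atTop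
      (𝓝 (∫⁻ _ : ℝ, 0)) := by
    refine tendsto_lintegral_filter_of_dominated_convergence' (fun u => ‖g u‖ₑ ^ (2 : ℝ)) ?_ ?_
      hsq ?_
    · refine .of_forall fun N => ?_
      exact ((hg.1.indicator measurableSet_Icc).sub hg.1).enorm.pow_const _
    · refine .of_forall fun N => .of_forall fun u => ?_
      by_cases hu : u ∈ Icc (-N) N <;> simp [hu]
    · refine .of_forall fun u => tendsto_const_nhds.congr' ?_
      filter_upwards [eventually_ge_atTop |u|] with N hN
      simp [indicator_of_mem (show u ∈ Icc (-N) N from abs_le.1 hN)]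
  rw [lintegral_zero] at h
  have h2 := (ENNReal.continuous_rpow_const (y := (1 / 2 : ℝ))).tendsto 0 |>.comp h
  rw [ENNReal.zero_rpow_of_pos (by norm_num)] at h2
  refine h2.congr fun N => ?_
  rw [eLpNorm_eq_lintegral_rpow_enorm_toReal (by norm_num) (by norm_num)]
  simp

theorem ae_eq_of_tendsto_eLpNorm_sub {p : ℝ → ℝ → ℂ} {a b : ℝ → ℂ} {μ : Measure ℝ}
    (hp : ∀ᶠ N in atTop, AEStronglyMeasurable (p N) μ)
    (ha : AEStronglyMeasurable a μ) (hb : AEStronglyMeasurable b μ)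
    (h1 : Tendsto (fun N => eLpNorm (p N - a) 2 μ) atTop (𝓝 0))
    (h2 : Tendsto (fun N => eLpNorm (p N - b) 2 μ) atTop (𝓝 0)) : a =ᵐ[μ] b := by
  have h := h1.add h2
  rw [add_zero] at h
  have h0 : eLpNorm (a - b) 2 μ ≤ 0 := by
    refine ge_of_tendsto h ?_
    filter_upwards [hp] with N hN
    calc eLpNorm (a - b) 2 μ = eLpNorm ((p N - b) - (p N - a)) 2 μ := by congr 1; abel
      _ ≤ eLpNorm (p N - b) 2 μ + eLpNorm (p N - a) 2 μ :=
        eLpNorm_sub_le (hN.sub hb) (hN.sub ha) (by norm_num)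
      _ = _ := add_comm _ _
  rw [nonpos_iff_eq_zero, eLpNorm_eq_zero_iff (ha.sub hb) (by norm_num)] at h0
  filter_upwards [h0] with x hx
  exact sub_eq_zero.1 hx

theorem eLpNorm_fourier_sub (a b : Lp ℂ 2 (volume : Measure ℝ)) :
    eLpNorm ((𝓕 a : Lp ℂ 2 (volume : Measure ℝ)) - (𝓕 b : Lp ℂ 2 (volume : Measure ℝ)) : ℝ → ℂ) 2
      volume = eLpNorm (a - b : ℝ → ℂ) 2 volume := by
  have h : ∀ c d : Lp ℂ 2 (volume : Measure ℝ),
      eLpNorm (c - d : ℝ → ℂ) 2 volume = ENNReal.ofReal ‖c - d‖ := by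
    intro c d
    rw [← eLpNorm_congr_ae (Lp.coeFn_sub c d), Lp.norm_def, ENNReal.ofReal_toReal (Lp.eLpNorm_ne_top _)]
  rw [h, h]
  congr 1
  have : (𝓕 a : Lp ℂ 2 (volume : Measure ℝ)) - 𝓕 b = 𝓕 (a - b) :=
    ((Lp.fourierTransformₗᵢ ℝ ℂ).map_sub a b).symm
  rw [this, Lp.norm_fourier_eq]

theorem cexp_ofReal_cpow (r : ℝ) (z : ℂ) : ((Real.exp r : ℝ) : ℂ) ^ z = Complex.exp (r * z) := by
  rw [Complex.cpow_def_of_ne_zero (by exact_mod_cast (Real.exp_pos r).ne'),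
    ← Complex.ofReal_log (Real.exp_pos r).le, Real.log_exp]

/-- Here t^(s-1) dt becomes e^{-u/2} e^{-2πiξu} du, which explains the weight in `logPull`, and
[1/N, N] becomes a symmetric interval. -/
theorem setIntegral_cpow_eq_fourier (f : ℝ → ℂ) {N : ℝ} (hN : 0 < N) (ξ : ℝ) :
    ∫ t in Icc (1 / N) N, f t * (t : ℂ) ^ (critPt (2 * Real.pi * ξ) - 1) =
      𝓕 ((Icc (-Real.log N) (Real.log N)).indicator (logPull f)) ξ := by
  have h1 : Icc (1 / N) N ⊆ Ioi 0 := fun t ht => lt_of_lt_of_le (by positivity) ht.1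
  have h2 : ∀ u : ℝ, Real.exp (-u) ∈ Icc (1 / N) N ↔ u ∈ Icc (-Real.log N) (Real.log N) := by
    intro u
    rw [mem_Icc, mem_Icc, one_div, ← Real.exp_log hN, ← Real.exp_neg, Real.exp_le_exp,
      Real.exp_le_exp, Real.exp_log hN, neg_le_neg_iff, neg_le, and_comm]
  calc ∫ t in Icc (1 / N) N, f t * (t : ℂ) ^ (critPt (2 * Real.pi * ξ) - 1)
      = ∫ t in Ioi 0, (Icc (1 / N) N).indicator
          (fun t : ℝ => f t * (t : ℂ) ^ (critPt (2 * Real.pi * ξ) - 1)) t := by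
        rw [setIntegral_indicator measurableSet_Icc, inter_eq_right.2 h1]
    _ = _ := by
        rw [integral_Ioi_eq_integral_exp_neg, Real.fourier_real_eq_integral_exp_smul]
        congr 1 with u
        by_cases hu : u ∈ Icc (-Real.log N) (Real.log N)
        · rw [indicator_of_mem hu, indicator_of_mem ((h2 u).2 hu), cexp_ofReal_cpow, logPull,
            smul_eq_mul, Complex.ofReal_exp, Complex.ofReal_exp, mul_left_comm, ← Complex.exp_add,
            ← mul_assoc, ← Complex.exp_add, mul_comm (f _)]
          congr 2
          rw [critPt]; push_cast; ring
        · rw [indicator_of_notMem hu, indicator_of_notMem (fun h => hu ((h2 u).1 h)), mul_zero,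
            smul_zero]

/-- On `L¹ ∩ L²` the inverse Fourier integral represents the inverse `L²` Fourier transform. -/
theorem fourierInv_toLp_ae_eq {h : ℝ → ℂ} (h1 : Integrable h) (h2 : MemLp h 2) :
    𝓕⁻ h =ᵐ[volume] (𝓕⁻ (h2.toLp h) : Lp ℂ 2 (volume : Measure ℝ)) := by
  have hn : MemLp (fun x => h (-x)) 2 :=
    h2.comp_measurePreserving (Measure.measurePreserving_neg volume)
  set b : Lp ℂ 2 (volume : Measure ℝ) := 𝓕 (hn.toLp _) with hb
  have e1 : 𝓕⁻ h =ᵐ[volume] b := by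
    rw [Real.fourierInv_eq_fourier_comp_neg]
    exact (fourier_toLp_ae_eq h1.comp_neg hn).symm
  have e2 : h2.toLp h = 𝓕 b :=
    Lp.ext (h2.coeFn_toLp.trans (ae_eq_fourier_of_fourierInv_ae_eq h1 b e1))
  rw [e2, FourierTransform.fourierInv_fourier_eq]
  exact e1

theorem LocallyIntegrable.comp_mul_left_real {p : ℝ → ℂ} (hp : LocallyIntegrable p) {c : ℝ}
    (hc : c ≠ 0) : LocallyIntegrable fun x => p (c * x) := by
  rw [locallyIntegrable_iff]
  intro K hK
  have hK' : IsCompact ((fun x => c * x) '' K) := hK.image (by fun_prop)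
  have h := (hp.integrableOn_isCompact hK').integrable_indicator hK'.measurableSet
  rw [← integrable_indicator_iff hK.measurableSet]
  refine ((integrable_comp_mul_left_iff _ hc).2 h).congr (.of_forall fun x => ?_)
  have hx : c * x ∈ (fun x => c * x) '' K ↔ x ∈ K :=
    (mul_right_injective₀ hc).mem_set_image
  beta_reduce
  by_cases hxK : x ∈ K
  · rw [indicator_of_mem hxK, indicator_of_mem (hx.2 hxK)]
  · rw [indicator_of_notMem hxK, indicator_of_notMem (fun h => hxK (hx.1 h))]

/-- By Plancherel the truncated Mellin integrals always converge in L² to the transform of `logPull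
f`, and L² limits are unique. -/
theorem isMellinTransformL2_iff {f : ℝ → ℂ} (hf : MemL2HalfLine f) (F : ℂ → ℂ) :
    IsMellinTransformL2 f F ↔
      (fun ξ : ℝ => F (critPt (2 * Real.pi * ξ))) =ᵐ[volume]
        (𝓕 ((memLp_logPull hf).toLp _) : Lp ℂ 2 (volume : Measure ℝ)) := by
  set g := (memLp_logPull hf).toLp (logPull f) with hg
  set gN : ℝ → ℝ → ℂ := fun N => (Icc (-Real.log N) (Real.log N)).indicator (logPull f) with hgN
  have hm : ∀ N, MemLp (gN N) 2 := fun N => (memLp_logPull hf).indicator measurableSet_Icc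
  have hi : ∀ N, Integrable (gN N) := fun N => by
    rw [hgN, integrable_indicator_iff measurableSet_Icc]
    exact ((memLp_logPull hf).locallyIntegrable (by norm_num)).integrableOn_isCompact isCompact_Icc
  have hlim : Tendsto (fun N => eLpNorm (𝓕 (gN N) - ⇑(𝓕 g : Lp ℂ 2 (volume : Measure ℝ))) 2 volume)
      atTop (𝓝 0) := by
    refine ((tendsto_eLpNorm_indicator_sub (memLp_logPull hf)).comp
      Real.tendsto_log_atTop).congr fun N => ?_
    rw [← eLpNorm_congr_ae ((fourier_toLp_ae_eq (hi N) (hm N)).sub (.refl _ _)),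
      eLpNorm_fourier_sub]
    exact (eLpNorm_congr_ae ((hm N).coeFn_toLp.sub (memLp_logPull hf).coeFn_toLp)).symm
  have hT : Tendsto (fun N : ℝ => eLpNorm (fun τ : ℝ =>
      (∫ t in Icc (1 / N) N, f t * (t : ℂ) ^ (critPt τ - 1)) - F (critPt τ)) 2 volume)
        atTop (𝓝 0) ↔
      Tendsto (fun N => eLpNorm (𝓕 (gN N) - fun ξ : ℝ => F (critPt (2 * Real.pi * ξ))) 2 volume)
        atTop (𝓝 0) := by
    rw [← tendsto_eLpNorm_comp_two_pi_mul_iff]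
    refine tendsto_congr' ?_
    filter_upwards [eventually_gt_atTop 0] with N hN
    congr 1 with ξ
    rw [setIntegral_cpow_eq_fourier f hN]
    rfl
  rw [IsMellinTransformL2, hT, ← memLp_comp_two_pi_mul_iff]
  have hFm : ∀ N, AEStronglyMeasurable (𝓕 (gN N)) volume := fun N =>
    (VectorFourier.fourierIntegral_continuous Real.continuous_fourierChar (by fun_prop)
      (hi N)).aestronglyMeasurable
  constructor
  · rintro ⟨h1, h2⟩
    exact ae_eq_of_tendsto_eLpNorm_sub (.of_forall hFm) h1.1 (Lp.aestronglyMeasurable _) h2 hlim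
  · intro h
    refine ⟨(memLp_congr_ae h).2 (Lp.memLp _), hlim.congr fun N => ?_⟩
    exact eLpNorm_congr_ae ((EventuallyEq.refl _ _).sub h.symm)

theorem logPull_integral_cpow_eq_fourierInv (F : ℂ → ℂ) (N u : ℝ) :
    logPull (fun x => 1 / (2 * (Real.pi : ℂ)) *
      ∫ τ in Icc (-N) N, F (critPt τ) * (x : ℂ) ^ (-critPt τ)) u =
      𝓕⁻ ((Icc (-(N / (2 * Real.pi))) (N / (2 * Real.pi))).indicator
        fun ξ : ℝ => F (critPt (2 * Real.pi * ξ))) u := by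
  have hπ : 0 < 2 * Real.pi := by positivity
  have hπ' : (Real.pi : ℂ) ≠ 0 := by exact_mod_cast Real.pi_pos.ne'
  have hmem : ∀ ξ : ℝ, 2 * Real.pi * ξ ∈ Icc (-N) N ↔
      ξ ∈ Icc (-(N / (2 * Real.pi))) (N / (2 * Real.pi)) := by
    intro ξ
    rw [mem_Icc, mem_Icc, ← neg_div, div_le_iff₀ hπ, le_div_iff₀ hπ, mul_comm ξ]
  rw [logPull, ← integral_indicator measurableSet_Icc, Real.fourierInv_eq']
  have h := Measure.integral_comp_mul_left (fun τ : ℝ => (Icc (-N) N).indicator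
    (fun τ : ℝ => F (critPt τ) * ((Real.exp (-u) : ℝ) : ℂ) ^ (-critPt τ)) τ) (2 * Real.pi)
  rw [abs_of_pos (inv_pos.2 hπ), Complex.real_smul] at h
  rw [show (1 / (2 * (Real.pi : ℂ))) = (((2 * Real.pi)⁻¹ : ℝ) : ℂ) by push_cast; ring, ← h,
    ← integral_const_mul]
  congr 1 with ξ
  by_cases hξ : ξ ∈ Icc (-(N / (2 * Real.pi))) (N / (2 * Real.pi))
  · rw [indicator_of_mem hξ, indicator_of_mem ((hmem ξ).2 hξ), cexp_ofReal_cpow, smul_eq_mul,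
      Complex.ofReal_exp, mul_left_comm, ← Complex.exp_add, mul_comm]
    congr 2
    rw [critPt]
    simp
    ring
  · rw [indicator_of_notMem hξ, indicator_of_notMem (fun h => hξ ((hmem ξ).1 h)), mul_zero,
      smul_zero]

/-- The delicate direction starts from a locally integrable F, whose truncations are integrable but
not known to be square integrable. Their inverse Fourier integrals are in L² for large N, and
`ae_eq_fourier_of_fourierInv_ae_eq` transfers this to the truncations; Plancherel then identifies
the limit. -/
theorem isMeanSquareMellinIntegral_iff {f : ℝ → ℂ} (hf : MemL2HalfLine f) (F : ℂ → ℂ) :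
    IsMeanSquareMellinIntegral F f ↔
      (fun ξ : ℝ => F (critPt (2 * Real.pi * ξ))) =ᵐ[volume]
        (𝓕 ((memLp_logPull hf).toLp _) : Lp ℂ 2 (volume : Measure ℝ)) := by
  have hπ : 0 < 2 * Real.pi := by positivity
  set g := (memLp_logPull hf).toLp (logPull f) with hg
  set G : ℝ → ℂ := fun ξ : ℝ => F (critPt (2 * Real.pi * ξ)) with hG
  set GN : ℝ → ℝ → ℂ := fun N => (Icc (-(N / (2 * Real.pi))) (N / (2 * Real.pi))).indicator G
    with hGN
  have hN : Tendsto (fun N : ℝ => N / (2 * Real.pi)) atTop atTop :=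
    tendsto_id.atTop_div_const hπ
  have hT : Tendsto (fun N : ℝ => eLpNorm (fun x : ℝ => f x - 1 / (2 * (Real.pi : ℂ)) *
      ∫ τ in Icc (-N) N, F (critPt τ) * (x : ℂ) ^ (-critPt τ)) 2
        (volume.restrict (Ioi (0 : ℝ)))) atTop (𝓝 0) ↔
      Tendsto (fun N => eLpNorm (logPull f - 𝓕⁻ (GN N)) 2 volume) atTop (𝓝 0) := by
    refine tendsto_congr fun N => ?_
    rw [← eLpNorm_logPull]
    congr 1 with u
    have := logPull_integral_cpow_eq_fourierInv F N u
    simp only [logPull] at this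
    rw [Pi.sub_apply, ← this, logPull, logPull, mul_sub]
  have hL : LocallyIntegrable (fun τ : ℝ => F (critPt τ)) volume ↔ LocallyIntegrable G := by
    refine ⟨fun h => LocallyIntegrable.comp_mul_left_real h hπ.ne', fun h => ?_⟩
    have := LocallyIntegrable.comp_mul_left_real h (inv_ne_zero hπ.ne')
    simpa only [hG, mul_inv_cancel_left₀ hπ.ne'] using this
  rw [IsMeanSquareMellinIntegral, hT, hL]
  have hc : ∀ N, Integrable (GN N) → Continuous (𝓕⁻ (GN N)) := fun N h => by
    have : 𝓕⁻ (GN N) = fun x => 𝓕 (GN N) (-x) := funext fun x => Real.fourierInv_eq_fourier_neg _ _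
    rw [this]
    exact (VectorFourier.fourierIntegral_continuous Real.continuous_fourierChar (by fun_prop)
      h).comp continuous_neg
  have hi : LocallyIntegrable G → ∀ N, Integrable (GN N) := fun h N => by
    rw [hGN, integrable_indicator_iff measurableSet_Icc]
    exact h.integrableOn_isCompact isCompact_Icc
  constructor
  · rintro ⟨h1, h2⟩
    -- An error norm tending to 0 is eventually finite, and `logPull f` is in L².
    have hmem : ∀ᶠ N in atTop, MemLp (𝓕⁻ (GN N)) 2 := by
      filter_upwards [h2.eventually (gt_mem_nhds ENNReal.zero_lt_top)] with N hN
      have hm := (hc N (hi h1 N)).aestronglyMeasurable (μ := volume)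
      have h3 : MemLp (logPull f - 𝓕⁻ (GN N)) 2 := ⟨(memLp_logPull hf).1.sub hm, hN⟩
      have := (memLp_logPull hf).sub h3
      rwa [sub_sub_cancel] at this
    have hlim : Tendsto (fun N => eLpNorm (GN N - ⇑(𝓕 g : Lp ℂ 2 (volume : Measure ℝ))) 2 volume)
        atTop (𝓝 0) := by
      refine h2.congr' ?_
      filter_upwards [hmem] with N hN
      have e := ae_eq_fourier_of_fourierInv_ae_eq (hi h1 N) (hN.toLp _) hN.coeFn_toLp.symm
      rw [eLpNorm_congr_ae (e.sub (.refl _ _)), eLpNorm_fourier_sub, ← eLpNorm_neg]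
      refine eLpNorm_congr_ae ?_
      filter_upwards [hN.coeFn_toLp, (memLp_logPull hf).coeFn_toLp] with u hu1 hu2
      simp only [Pi.neg_apply, Pi.sub_apply, hu1, hg, hu2, neg_sub]
    -- On a fixed interval the truncations eventually equal G itself, so G agrees there with their
    -- L² limit.
    have hball : ∀ M : ℕ, ∀ᵐ ξ ∂(volume.restrict (Icc (-(M : ℝ)) M)),
        G ξ = (𝓕 g : Lp ℂ 2 (volume : Measure ℝ)) ξ := by
      intro M
      refine ae_eq_of_tendsto_eLpNorm_sub (p := GN) (.of_forall fun N => ?_)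
        h1.aestronglyMeasurable.restrict (Lp.aestronglyMeasurable _).restrict ?_ ?_
      · exact (hi h1 N).aestronglyMeasurable.restrict
      · refine tendsto_const_nhds.congr' ?_
        filter_upwards [hN.eventually_ge_atTop (M : ℝ)] with N hN'
        have : GN N - G =ᵐ[volume.restrict (Icc (-(M : ℝ)) M)] 0 := by
          filter_upwards [ae_restrict_mem measurableSet_Icc] with ξ hξ
          have : ξ ∈ Icc (-(N / (2 * Real.pi))) (N / (2 * Real.pi)) :=
            ⟨by linarith [hξ.1], hξ.2.trans hN'⟩
          simp [hGN, this]
        rw [eLpNorm_congr_ae this, eLpNorm_zero]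
      · exact tendsto_of_tendsto_of_tendsto_of_le_of_le tendsto_const_nhds hlim
          (fun _ => zero_le) fun N => eLpNorm_mono_measure _ Measure.restrict_le_self
    have hU : (⋃ M : ℕ, Icc (-(M : ℝ)) M) = univ := by
      refine eq_univ_of_forall fun ξ => mem_iUnion.2 ?_
      obtain ⟨M, hM⟩ := exists_nat_ge |ξ|
      exact ⟨M, abs_le.1 hM⟩
    have := ae_restrict_iUnion_iff (μ := (volume : Measure ℝ)) (fun M : ℕ => Icc (-(M : ℝ)) M)
      (fun ξ => G ξ = (𝓕 g : Lp ℂ 2 (volume : Measure ℝ)) ξ) |>.2 hball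
    rwa [hU, Measure.restrict_univ] at this
  · intro h
    have hGm : MemLp G 2 := (memLp_congr_ae h).2 (Lp.memLp _)
    have hGl : LocallyIntegrable G := hGm.locallyIntegrable (by norm_num)
    refine ⟨hGl, ?_⟩
    have hlim := (tendsto_eLpNorm_indicator_sub hGm).comp hN
    refine hlim.congr fun N => ?_
    have hGNm : MemLp (GN N) 2 := hGm.indicator measurableSet_Icc
    have e := fourierInv_toLp_ae_eq (hi hGl N) hGNm
    set k : Lp ℂ 2 (volume : Measure ℝ) := 𝓕⁻ (hGNm.toLp _) with hk
    have hFk : 𝓕 k = hGNm.toLp _ := FourierTransform.fourier_fourierInv_eq _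
    rw [eLpNorm_congr_ae (((memLp_logPull hf).coeFn_toLp.symm).sub e), ← hg, ← eLpNorm_fourier_sub,
      hFk, ← eLpNorm_neg]
    refine eLpNorm_congr_ae ?_
    filter_upwards [h, hGNm.coeFn_toLp] with ξ h1 h2
    simp only [Pi.neg_apply, Pi.sub_apply] at *
    rw [← h1, h2, neg_sub]

/-! ### Symmetric numerators on the critical line. -/

theorem ae_comp_neg {P : ℝ → Prop} (h : ∀ᵐ x : ℝ, P x) : ∀ᵐ x : ℝ, P (-x) :=
  (Measure.measurePreserving_neg (volume : Measure ℝ)).quasiMeasurePreserving.ae h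

/-- A function on the critical line is a symmetric function divided by `den` iff its product with
`den` is symmetric. -/
theorem exists_symmetric_div_ae_eq_iff {den : ℂ → ℂ} {D : ℝ → ℂ}
    (hD : ∀ ξ : ℝ, den (critPt (2 * Real.pi * ξ)) = D ξ) (hD0 : ∀ ξ, D ξ ≠ 0) (G : ℝ → ℂ) :
    (∃ φ : ℂ → ℂ, SymmetricOnCritLine φ ∧
      (fun ξ : ℝ => φ (critPt (2 * Real.pi * ξ)) / den (critPt (2 * Real.pi * ξ))) =ᵐ[volume] G) ↔
      ∀ᵐ ξ : ℝ, G (-ξ) * D (-ξ) = G ξ * D ξ := by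
  have hre : ∀ τ : ℝ, (critPt τ).re = 1 / 2 := fun τ => by simp [critPt]
  have him : ∀ τ : ℝ, (critPt τ).im = τ := fun τ => by simp [critPt]
  constructor
  · rintro ⟨φ, hφ, h⟩
    filter_upwards [h, ae_comp_neg h] with ξ h1 h2
    rw [← h1, ← h2, hD, hD, div_mul_cancel₀ _ (hD0 _), div_mul_cancel₀ _ (hD0 _), mul_neg,
      critPt_neg, ← hφ _ (hre _)]
  · intro h
    -- The product G·D is even only almost everywhere, whereas φ must be symmetric at every point;
    -- averaging over ±ξ achieves this and alters φ only on a null set.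
    refine ⟨fun s => (G (s.im / (2 * Real.pi)) * D (s.im / (2 * Real.pi)) +
      G (-(s.im / (2 * Real.pi))) * D (-(s.im / (2 * Real.pi)))) / 2, fun s hs => ?_, ?_⟩
    · simp only [Complex.sub_im, Complex.one_im, zero_sub, neg_div, neg_neg]
      rw [add_comm]
    · filter_upwards [h] with ξ hξ
      have e : 2 * Real.pi * ξ / (2 * Real.pi) = ξ :=
        mul_div_cancel_left₀ ξ (by positivity : (2 * Real.pi : ℝ) ≠ 0)
      rw [him, e, hξ, hD, add_self_div_two, mul_div_cancel_right₀ _ (hD0 ξ)]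

/-! ### Even and odd extensions and principal values on the half-line. -/

theorem MemL2HalfLine.memLp_indicator {f : ℝ → ℂ} (hf : MemL2HalfLine f) :
    MemLp ((Ioi (0 : ℝ)).indicator f) 2 :=
  (memLp_indicator_iff_restrict measurableSet_Ioi).2 hf

theorem memL2HalfLine_of_memLp {f : ℝ → ℂ} (hf : MemLp f 2) : MemL2HalfLine f :=
  hf.restrict _

/-- The extension of `f` from `(0, ∞)` to the line with `E (-t) = c E t`, for `c = ±1`. -/
noncomputable def parityExt (c : ℂ) (f : ℝ → ℂ) (t : ℝ) : ℂ :=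
  (Ioi (0 : ℝ)).indicator f t + c * (Ioi (0 : ℝ)).indicator f (-t)

theorem memLp_parityExt (c : ℂ) {f : ℝ → ℂ} (hf : MemL2HalfLine f) :
    MemLp (parityExt c f) 2 :=
  hf.memLp_indicator.add ((hf.memLp_indicator.comp_measurePreserving
    (Measure.measurePreserving_neg volume)).const_mul c)

theorem parityExt_neg {c : ℂ} (hc : c * c = 1) (f : ℝ → ℂ) (t : ℝ) :
    parityExt c f (-t) = c * parityExt c f t := by
  simp only [parityExt, neg_neg]
  linear_combination (-(Ioi (0 : ℝ)).indicator f (-t)) * hc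

theorem ae_eq_parityExt {c : ℂ} (hc : c * c = 1) {b : ℝ → ℂ} (hb : ∀ᵐ t, b (-t) = c * b t) :
    b =ᵐ[volume] parityExt c b := by
  have h0 : ∀ᵐ t : ℝ, t ≠ 0 := by simp [ae_iff]
  filter_upwards [hb, h0] with t ht h0
  rcases lt_or_gt_of_ne h0 with h | h
  · have h1 : t ∉ Ioi (0 : ℝ) := fun h' => lt_asymm h h'
    have h2 : -t ∈ Ioi (0 : ℝ) := neg_pos.2 h
    rw [parityExt, indicator_of_notMem h1, indicator_of_mem h2, ht]
    linear_combination (-b t) * hc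
  · have h1 : t ∈ Ioi (0 : ℝ) := h
    have h2 : -t ∉ Ioi (0 : ℝ) := fun h' => by
      have : 0 < -t := h'
      linarith
    rw [parityExt, indicator_of_mem h1, indicator_of_notMem h2, mul_zero, add_zero]

theorem integral_parityExt_mul (c : ℂ) {f k : ℝ → ℂ} (hf : MemL2HalfLine f) (hk : MemLp k 2) :
    ∫ t, parityExt c f t * k t = ∫ t in Ioi 0, f t * (k t + c * k (-t)) := by
  have hn := Measure.measurePreserving_neg (volume : Measure ℝ)
  have h1 := integrable_mul_of_memLp_two hf.memLp_indicator hk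
  have h2 := integrable_mul_of_memLp_two (hf.memLp_indicator.comp_measurePreserving hn) hk
  have h3 := integrable_mul_of_memLp_two hf.memLp_indicator (hk.comp_measurePreserving hn)
  simp only [Function.comp_apply] at h2 h3
  calc ∫ t, parityExt c f t * k t
      = ∫ t, ((Ioi (0 : ℝ)).indicator f t * k t +
          c * ((Ioi (0 : ℝ)).indicator f (-t) * k t)) := by
        congr 1 with t; rw [parityExt]; ring
    _ = (∫ t, (Ioi (0 : ℝ)).indicator f t * k t) +
          c * ∫ t, (Ioi (0 : ℝ)).indicator f t * k (-t) := by
        rw [integral_add h1 (h2.const_mul c), integral_const_mul, ← integral_neg_eq_self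
          (fun t => (Ioi (0 : ℝ)).indicator f (-t) * k t)]
        simp only [neg_neg]
    _ = ∫ t, (Ioi (0 : ℝ)).indicator (fun t => f t * (k t + c * k (-t))) t := by
        rw [← integral_const_mul, ← integral_add h1 (h3.const_mul c)]
        congr 1 with t
        by_cases ht : t ∈ Ioi (0 : ℝ)
        · simp only [indicator_of_mem ht]; ring
        · simp only [indicator_of_notMem ht]; ring
    _ = _ := integral_indicator measurableSet_Ioi

theorem HasPVIntegral.const_mul {k : ℝ → ℂ} {a : ℝ} {v : ℂ} (h : HasPVIntegral k a v) (d : ℂ) :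
    HasPVIntegral (fun t => d * k t) a (d * v) :=
  ⟨fun ε hε => (h.1 ε hε).const_mul d, by
    simpa only [integral_const_mul] using h.2.const_mul d⟩

theorem measurableSet_truncation (a ε : ℝ) : MeasurableSet {t : ℝ | 0 < t ∧ ε < |t - a|} :=
  measurableSet_Ioi.inter (measurableSet_lt measurable_const
    (by fun_prop : Measurable fun t : ℝ => |t - a|))

theorem HasPVIntegral.congr {k k' : ℝ → ℂ} {a : ℝ} {v : ℂ} (h : HasPVIntegral k a v)
    (hk : ∀ t, 0 < t → t ≠ a → k t = k' t) : HasPVIntegral k' a v := by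
  have he : ∀ ε : ℝ, 0 < ε → EqOn k k' {t : ℝ | 0 < t ∧ ε < |t - a|} := fun ε hε t ht =>
    hk t ht.1 fun h0 => by
      have := ht.2
      rw [h0, sub_self, abs_zero] at this
      linarith
  refine ⟨fun ε hε => (h.1 ε hε).congr_fun (he ε hε) (measurableSet_truncation a ε), ?_⟩
  refine h.2.congr' ?_
  filter_upwards [self_mem_nhdsWithin] with ε hε
  exact setIntegral_congr_fun (measurableSet_truncation a ε) (he ε hε)

theorem HasPVIntegral.unique {k : ℝ → ℂ} {a : ℝ} {v w : ℂ} (h : HasPVIntegral k a v)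
    (h' : HasPVIntegral k a w) : v = w :=
  tendsto_nhds_unique h.2 h'.2

/-- The principal value over the half-line comes from the truncated Hilbert integrals of the
even or odd extension. -/
theorem hasPVIntegral_of_tendsto_trunc {c : ℂ} {f : ℝ → ℂ} (hf : MemL2HalfLine f) {x : ℝ}
    (hx : 0 < x) {v : ℂ}
    (h : Tendsto (fun ε => ∫ t, parityExt c f t * (truncKer ε (x - t) : ℂ)) (𝓝[>] 0) (𝓝 v)) :
    HasPVIntegral (fun t => f t * (1 / ((x : ℂ) - t) + c * (1 / ((x : ℂ) + t)))) x v := by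
  set A : ℝ → Set ℝ := fun ε => {t : ℝ | 0 < t ∧ ε < |t - x|} with hA
  have hAm : ∀ ε, MeasurableSet (A ε) := measurableSet_truncation x
  have hAs : ∀ ε, A ε ⊆ Ioi 0 := fun ε t ht => ht.1
  have hpl : IntegrableOn (fun t => f t * (1 / ((x : ℂ) + t))) (Ioi 0) := by
    -- For t > 0 one has x + t > x/2, so the truncated kernel at this level is exactly 1/(x + t) and
    -- is known to be in L².
    have h1 : MemLp (fun t => (truncKer (x / 2) (x - (-t)) : ℂ)) 2 :=
      (memLp_truncKer (half_pos hx) x).comp_measurePreserving (Measure.measurePreserving_neg volume)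
    refine IntegrableOn.congr_fun (integrable_mul_of_memLp_two hf (h1.restrict (Ioi 0)))
      (fun t ht => ?_) measurableSet_Ioi
    have ht' : 0 < t := ht
    rw [truncKer, sub_neg_eq_add, if_pos (by rw [abs_of_pos (by linarith)]; linarith)]
    push_cast
    rfl
  have htr : ∀ ε, 0 < ε → IntegrableOn (fun t => f t * (truncKer ε (x - t) : ℂ)) (Ioi 0) :=
    fun ε hε => integrable_mul_of_memLp_two hf ((memLp_truncKer hε x).restrict (Ioi 0))
  have hkin : ∀ ε, ∀ t ∈ A ε, (truncKer ε (x - t) : ℂ) = 1 / ((x : ℂ) - t) := by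
    intro ε t ht
    rw [truncKer, if_pos (by rw [abs_sub_comm]; exact ht.2)]
    push_cast
    rfl
  have hkout : ∀ ε, ∀ t ∈ Ioi 0 \ A ε, (truncKer ε (x - t) : ℂ) = 0 := by
    intro ε t ht
    rw [truncKer, if_neg (fun h' => ht.2 ⟨ht.1, by rwa [abs_sub_comm]⟩), Complex.ofReal_zero]
  -- On the whole line only the singular term is cut near t = x, whereas the half-line truncation
  -- also removes the regular term 1/(x + t) there. For ε < x that term is never cut by `truncKer`,
  -- so it is the entire discrepancy.
  have hsplit : ∀ ε, 0 < ε → ε < x → ∫ t, parityExt c f t * (truncKer ε (x - t) : ℂ) =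
      (∫ t in A ε, f t * (1 / ((x : ℂ) - t) + c * (1 / ((x : ℂ) + t)))) +
        ∫ t in Ioi 0 \ A ε, c * (f t * (1 / ((x : ℂ) + t))) := by
    intro ε hε hεx
    have e0 : ∀ t ∈ Ioi (0 : ℝ), f t * ((truncKer ε (x - t) : ℂ) + c * (truncKer ε (x - -t) : ℂ)) =
        f t * (truncKer ε (x - t) : ℂ) + c * (f t * (1 / ((x : ℂ) + t))) := by
      intro t ht
      have ht' : 0 < t := ht
      rw [truncKer, truncKer, sub_neg_eq_add x t,
        if_pos (show ε < |x + t| by rw [abs_of_pos (by linarith)]; linarith)]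
      push_cast
      ring
    have hint : IntegrableOn (fun t => f t * (truncKer ε (x - t) : ℂ) +
        c * (f t * (1 / ((x : ℂ) + t)))) (Ioi 0) := (htr ε hε).add (hpl.const_mul c)
    rw [integral_parityExt_mul c hf (memLp_truncKer hε x), setIntegral_congr_fun measurableSet_Ioi e0,
      ← integral_inter_add_sdiff (hAm ε) hint,
      inter_eq_right.2 (hAs ε)]
    congr 1
    · refine setIntegral_congr_fun (hAm ε) fun t ht => ?_
      simp only [hkin ε t ht]
      ring
    · refine setIntegral_congr_fun (measurableSet_Ioi.diff (hAm ε)) fun t ht => ?_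
      simp only [hkout ε t ht]
      ring
  refine ⟨fun ε hε => ?_, ?_⟩
  · refine IntegrableOn.congr_fun (((htr ε hε).add (hpl.const_mul c)).mono_set (hAs ε))
      (fun t ht => ?_) (hAm ε)
    simp only [Pi.add_apply, hkin ε t ht]
    ring
  · have hrem : Tendsto (fun ε => ∫ t in Ioi 0 \ A ε, c * (f t * (1 / ((x : ℂ) + t)))) (𝓝[>] 0)
        (𝓝 0) := by
      have hint : Integrable ((Ioi (0 : ℝ)).indicator fun t => c * (f t * (1 / ((x : ℂ) + t)))) :=
        IntegrableOn.integrable_indicator (hpl.const_mul c) measurableSet_Ioi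
      -- The removed set has measure at most 2ε, so absolute continuity of the integral disposes of
      -- the remainder.
      have hvol : Tendsto (volume ∘ fun ε => Ioi 0 \ A ε) (𝓝[>] 0) (𝓝 0) := by
        have h1 : Tendsto (fun ε : ℝ => ENNReal.ofReal (2 * ε)) (𝓝[>] 0) (𝓝 0) := by
          have : Continuous fun ε : ℝ => ENNReal.ofReal (2 * ε) :=
            ENNReal.continuous_ofReal.comp (by fun_prop)
          simpa using (this.tendsto 0).mono_left nhdsWithin_le_nhds
        refine tendsto_of_tendsto_of_tendsto_of_le_of_le tendsto_const_nhds h1 (fun _ => zero_le)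
          fun ε => ?_
        rw [← Real.volume_closedBall x ε]
        refine measure_mono fun t ht => ?_
        rw [Metric.mem_closedBall, Real.dist_eq]
        exact not_lt.1 fun h' => ht.2 ⟨ht.1, h'⟩
      refine (hint.tendsto_setIntegral_nhds_zero hvol).congr fun ε => ?_
      exact setIntegral_congr_fun (measurableSet_Ioi.diff (hAm ε)) fun t ht =>
        indicator_of_mem ht.1 _
    have := h.sub hrem
    rw [sub_zero] at this
    refine this.congr' ?_
    filter_upwards [Ioo_mem_nhdsGT hx] with ε hε
    rw [hsplit ε hε.1 hε.2, add_sub_cancel_right]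

/-! ### Mellin multipliers of the Hilbert transform and of the reflection x ↦ 1/x. -/

/-- Stieltjes-type identities between `p` and `q` on the half-line become a multiplier identity
between their `L²` Mellin transforms. -/
theorem fourier_logPull_mul_critCos_ae_eq {p q : ℝ → ℂ} (hp : MemL2HalfLine p)
    (hq : MemL2HalfLine q)
    (h : ∀ ε : ℝ, 0 < ε → ∫ t in Ioi 0, p t * (conjPoissonKer ε t : ℂ) =
      ∫ t in Ioi 0, q t * (poissonKer ε t : ℂ)) :
    ∀ᵐ ξ, (𝓕 ((memLp_logPull hp).toLp _) : Lp ℂ 2 (volume : Measure ℝ)) ξ * critCos ξ =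
      (𝓕 ((memLp_logPull hq).toLp _) : Lp ℂ 2 (volume : Measure ℝ)) ξ * critCos (-ξ) := by
  refine fourier_mul_critCos_ae_eq fun v => ?_
  -- With ε = e^{-v} both kernels become, up to the common factor e^{v/2} and the weight e^{-u/2}
  -- absorbed by `logPull`, functions of u - v alone.
  have hv := h (Real.exp (-v)) (Real.exp_pos _)
  rw [integral_Ioi_eq_integral_exp_neg, integral_Ioi_eq_integral_exp_neg] at hv
  have hden : ∀ u, Real.exp (u - v) + Real.exp (-(u - v)) =
      Real.exp (u + v) * (Real.exp (-u) ^ 2 + Real.exp (-v) ^ 2) := by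
    intro u
    rw [mul_add, ← Real.exp_nat_mul, ← Real.exp_nat_mul, ← Real.exp_add, ← Real.exp_add, add_comm]
    push_cast
    ring_nf
  have e1 : ∀ u, Real.exp (-u) * conjPoissonKer (Real.exp (-v)) (Real.exp (-u)) =
      Real.exp (v / 2) * (Real.exp (-u / 2) * logKer (u - v)) := by
    intro u
    rw [logKer, hden, conjPoissonKer, mul_div_assoc', mul_div_assoc', mul_div_assoc',
      div_eq_div_iff (by positivity) (by positivity), ← mul_assoc, ← mul_assoc, ← Real.exp_add,
      ← Real.exp_add, ← Real.exp_add, ← Real.exp_add]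
    ring_nf
  have e2 : ∀ u, Real.exp (-u) * poissonKer (Real.exp (-v)) (Real.exp (-u)) =
      Real.exp (v / 2) * (Real.exp (-u / 2) * logKer (v - u)) := by
    intro u
    rw [logKer, ← neg_sub u v, neg_neg, add_comm (Real.exp (-(u - v))), hden, poissonKer,
      mul_div_assoc', mul_div_assoc', mul_div_assoc',
      div_eq_div_iff (by positivity) (by positivity), ← mul_assoc, ← mul_assoc, ← Real.exp_add,
      ← Real.exp_add, ← Real.exp_add, ← Real.exp_add]
    ring_nf
  have h1 : ∫ u, (Real.exp (-u) : ℂ) * (p (Real.exp (-u)) *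
      (conjPoissonKer (Real.exp (-v)) (Real.exp (-u)) : ℂ)) =
      (Real.exp (v / 2) : ℂ) * ∫ u, logPull p u * (logKer (u - v) : ℂ) := by
    rw [← integral_const_mul]
    congr 1 with u
    rw [mul_left_comm, ← Complex.ofReal_mul, e1, logPull]
    push_cast
    ring
  have h2 : ∫ u, (Real.exp (-u) : ℂ) * (q (Real.exp (-u)) *
      (poissonKer (Real.exp (-v)) (Real.exp (-u)) : ℂ)) =
      (Real.exp (v / 2) : ℂ) * ∫ u, logPull q u * (logKer (v - u) : ℂ) := by
    rw [← integral_const_mul]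
    congr 1 with u
    rw [mul_left_comm, ← Complex.ofReal_mul, e2, logPull]
    push_cast
    ring
  rw [h1, h2] at hv
  have hv' := mul_left_cancel₀ (by exact_mod_cast (Real.exp_pos _).ne') hv
  calc _ = ∫ u, logPull p u * (logKer (u - v) : ℂ) := by
        refine integral_congr_ae ?_
        filter_upwards [(memLp_logPull hp).coeFn_toLp] with u hu
        rw [hu]
    _ = ∫ u, logPull q u * (logKer (v - u) : ℂ) := hv'
    _ = _ := by
        refine integral_congr_ae ?_
        filter_upwards [(memLp_logPull hq).coeFn_toLp] with u hu
        rw [hu]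

/-- In the logarithmic variable the operation on f is u ↦ -u, which commutes with the Fourier
transform; injectivity of the latter on L² gives the converse. -/
theorem one_div_mul_comp_one_div_ae_eq_iff {f w : ℝ → ℂ} (hf : MemL2HalfLine f)
    (hw : MemL2HalfLine w) :
    (∀ᵐ x : ℝ ∂(volume.restrict (Ioi (0 : ℝ))), 1 / (x : ℂ) * f (1 / x) = w x) ↔
      ∀ᵐ ξ, (𝓕 ((memLp_logPull hf).toLp _) : Lp ℂ 2 (volume : Measure ℝ)) (-ξ) =
        (𝓕 ((memLp_logPull hw).toLp _) : Lp ℂ 2 (volume : Measure ℝ)) ξ := by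
  have hn : MemLp (fun u => logPull f (-u)) 2 :=
    (memLp_logPull hf).comp_measurePreserving (Measure.measurePreserving_neg volume)
  have e : ∀ u : ℝ, (1 / ((Real.exp (-u) : ℝ) : ℂ) * f (1 / Real.exp (-u)) = w (Real.exp (-u))) ↔
      logPull f (-u) = logPull w u := by
    intro u
    rw [logPull, logPull, neg_neg]
    have h1 : (1 : ℝ) / Real.exp (-u) = Real.exp u := by rw [one_div, ← Real.exp_neg, neg_neg]
    have h2 : (1 : ℂ) / ((Real.exp (-u) : ℝ) : ℂ) = ((Real.exp u : ℝ) : ℂ) := by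
      rw [← h1]; push_cast; rfl
    have h3 : Real.exp (u / 2) = Real.exp (-u / 2) * Real.exp u := by
      rw [← Real.exp_add]; ring_nf
    rw [h1, h2, h3, Complex.ofReal_mul, mul_assoc]
    exact (mul_right_inj' (by exact_mod_cast (Real.exp_pos _).ne')).symm
  have hneg : ∀ᵐ x, (𝓕 (hn.toLp _) : Lp ℂ 2 (volume : Measure ℝ)) x =
      (𝓕 ((memLp_logPull hf).toLp _) : Lp ℂ 2 (volume : Measure ℝ)) (-x) := by
    refine fourier_comp_neg_ae_eq _ _ ?_
    filter_upwards [hn.coeFn_toLp, ae_comp_neg (memLp_logPull hf).coeFn_toLp] with u h1 h2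
    rw [h1, h2]
  rw [ae_Ioi_iff_ae_exp_neg]
  simp only [e]
  calc (∀ᵐ u, logPull f (-u) = logPull w u) ↔
      hn.toLp _ = (memLp_logPull hw).toLp _ := (MemLp.toLp_eq_toLp_iff hn (memLp_logPull hw)).symm
    _ ↔ (𝓕 (hn.toLp _) : Lp ℂ 2 (volume : Measure ℝ)) = 𝓕 ((memLp_logPull hw).toLp _) :=
        (Lp.fourierTransformₗᵢ ℝ ℂ).injective.eq_iff.symm
    _ ↔ _ := by
        rw [Lp.ext_iff]
        constructor <;> intro h
        · filter_upwards [h, hneg] with ξ h1 h2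
          rw [← h1, h2]
        · filter_upwards [h, hneg] with ξ h1 h2
          rw [← h1, h2]

/-- The Hilbert transform of the extension of parity `c = ±1` of `f`, on the half-line. -/
theorem exists_halfLine_hilbert {c : ℂ} (hc : c * c = 1) {f : ℝ → ℂ} (hf : MemL2HalfLine f) :
    ∃ b : ℝ → ℂ, MemL2HalfLine b ∧
      (∀ᵐ x : ℝ ∂volume.restrict (Ioi (0 : ℝ)), HasPVIntegral
        (fun t => f t * (1 / ((x : ℂ) - t) + c * (1 / ((x : ℂ) + t)))) x (Real.pi * b x)) ∧
      (∀ ε : ℝ, 0 < ε →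
        (1 - c) * ∫ t in Ioi 0, f t * (conjPoissonKer ε t : ℂ) =
          (1 - c) * ∫ t in Ioi 0, -b t * (poissonKer ε t : ℂ)) ∧
      (∀ ε : ℝ, 0 < ε →
        (1 + c) * ∫ t in Ioi 0, b t * (conjPoissonKer ε t : ℂ) =
          (1 + c) * ∫ t in Ioi 0, f t * (poissonKer ε t : ℂ)) := by
  set a := (memLp_parityExt c hf).toLp (parityExt c f) with ha
  have hae : a =ᵐ[volume] parityExt c f := (memLp_parityExt c hf).coeFn_toLp
  obtain ⟨b, hb⟩ := exists_conjugate_function a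
  have hbm : MemL2HalfLine b := memL2HalfLine_of_memLp (Lp.memLp b)
  have hI : ∀ k : ℝ → ℂ, ∫ t, a t * k t = ∫ t, parityExt c f t * k t := fun k =>
    integral_congr_ae (by filter_upwards [hae] with t ht; rw [ht])
  have hlim := ae_tendsto_truncated_hilbert (memLp_parityExt c hf) (Lp.memLp b)
    fun ε hε x => by rw [← hI, (hb ε hε x).1]
  -- The truncated kernel is odd, so the Hilbert transform reverses parity; this is read off from
  -- the almost everywhere limits.
  have hpar : ∀ᵐ x, b (-x) = -c * b x := by
    filter_upwards [hlim, ae_comp_neg hlim] with x h1 h2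
    have h3 : Tendsto (fun ε => ∫ t, parityExt c f t * (truncKer ε (-x - t) : ℂ)) (𝓝[>] 0)
        (𝓝 (-c * (Real.pi * b x))) := by
      refine (h1.const_mul (-c)).congr fun ε => ?_
      rw [← integral_const_mul, ← integral_neg_eq_self
        (fun t => parityExt c f t * (truncKer ε (-x - t) : ℂ))]
      congr 1 with t
      rw [parityExt_neg hc, show -x - -t = -(x - t) by ring, truncKer_neg]
      push_cast
      ring
    have hπ' : (Real.pi : ℂ) ≠ 0 := by exact_mod_cast Real.pi_pos.ne'
    refine mul_left_cancel₀ hπ' ?_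
    rw [tendsto_nhds_unique h2 h3]
    ring
  have hcc : -c * -c = 1 := by rw [neg_mul_neg, hc]
  have hbext := ae_eq_parityExt hcc hpar
  have hIb : ∀ k : ℝ → ℂ, ∫ t, b t * k t = ∫ t, parityExt (-c) b t * k t := fun k =>
    integral_congr_ae (by filter_upwards [hbext] with t ht; rw [← ht])
  have hPneg : ∀ ε t, poissonKer ε (-t) = poissonKer ε t := fun ε t => by
    rw [poissonKer, poissonKer, neg_sq]
  refine ⟨b, hbm, ?_, fun ε hε => ?_, fun ε hε => ?_⟩
  · rw [ae_restrict_iff' measurableSet_Ioi]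
    filter_upwards [hlim] with x hx hx0
    exact hasPVIntegral_of_tendsto_trunc hf hx0 hx
  -- At x = 0 folding the line onto the half-line gives the factor 1 - c on both sides. It vanishes
  -- for c = 1, so this identity is informative for the odd extension only, and the next one, with 1
  -- + c, for the even extension.
  · have h := (hb ε hε 0).1
    rw [hI, hIb, integral_parityExt_mul c hf (memLp_conjPoissonKer hε 0),
      integral_parityExt_mul (-c) hbm (memLp_poissonKer hε 0)] at h
    rw [← integral_const_mul, ← integral_const_mul]
    rw [← neg_inj, ← integral_neg, ← integral_neg] at h
    simp only [zero_sub, neg_neg, conjPoissonKer_neg, hPneg] at h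
    refine Eq.trans ?_ (h.trans ?_) <;>
    · congr 1 with t
      push_cast
      ring
  · have h := (hb ε hε 0).2
    rw [hI, hIb, integral_parityExt_mul c hf (memLp_poissonKer hε 0),
      integral_parityExt_mul (-c) hbm (memLp_conjPoissonKer hε 0)] at h
    rw [← integral_const_mul, ← integral_const_mul]
    rw [← neg_inj, neg_neg, ← integral_neg] at h
    simp only [zero_sub, neg_neg, conjPoissonKer_neg, hPneg] at h
    refine Eq.trans ?_ (h.trans ?_) <;>
    · congr 1 with t
      push_cast
      ring

/-! ### From the integral equations to evenness of the weighted transform, and conclusion. -/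

/-- Evenness of the transform times D is the common form to which every condition is reduced. -/
theorem tfae_mellin_conditions {f : ℝ → ℂ} (hf : MemL2HalfLine f) {den : ℂ → ℂ} {D : ℝ → ℂ}
    (hD : ∀ ξ : ℝ, den (critPt (2 * Real.pi * ξ)) = D ξ) (hD0 : ∀ ξ, D ξ ≠ 0) {p q : Prop}
    (hpq : p ↔ q)
    (hp : p ↔ ∀ᵐ ξ : ℝ, (𝓕 ((memLp_logPull hf).toLp _) : Lp ℂ 2 (volume : Measure ℝ)) (-ξ) * D (-ξ) =
      (𝓕 ((memLp_logPull hf).toLp _) : Lp ℂ 2 (volume : Measure ℝ)) ξ * D ξ) :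
    List.TFAE [p, q,
      ∃ φ : ℂ → ℂ, SymmetricOnCritLine φ ∧ IsMeanSquareMellinIntegral (fun s => φ s / den s) f,
      ∃ φ : ℂ → ℂ, SymmetricOnCritLine φ ∧ IsMellinTransformL2 f (fun s => φ s / den s)] := by
  have h3 : (∃ φ : ℂ → ℂ, SymmetricOnCritLine φ ∧
      IsMeanSquareMellinIntegral (fun s => φ s / den s) f) ↔ p := by
    rw [hp, ← exists_symmetric_div_ae_eq_iff hD hD0]
    simp only [isMeanSquareMellinIntegral_iff hf]
  have h4 : (∃ φ : ℂ → ℂ, SymmetricOnCritLine φ ∧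
      IsMellinTransformL2 f (fun s => φ s / den s)) ↔ p := by
    rw [hp, ← exists_symmetric_div_ae_eq_iff hD hD0]
    simp only [isMellinTransformL2_iff hf]
  tfae_have 1 ↔ 2 := hpq
  tfae_have 3 ↔ 1 := h3
  tfae_have 4 ↔ 1 := h4
  tfae_finish

/-- Principal values are unique, so once they are known almost everywhere the existential quantifier
can be replaced by the known value. -/
theorem ae_exists_hasPVIntegral_iff {k : ℝ → ℝ → ℂ} {T h : ℝ → ℂ} {d : ℂ}
    (hT : ∀ᵐ x : ℝ ∂(volume.restrict (Ioi (0 : ℝ))), HasPVIntegral (k x) x (T x)) :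
    (∀ᵐ x : ℝ ∂(volume.restrict (Ioi (0 : ℝ))), ∃ v : ℂ, HasPVIntegral (k x) x v ∧ h x = d * v) ↔
      ∀ᵐ x : ℝ ∂(volume.restrict (Ioi (0 : ℝ))), h x = d * T x := by
  constructor
  · intro H
    filter_upwards [H, hT] with x ⟨v, hv, hx⟩ hTx
    rw [hx, hv.unique hTx]
  · intro H
    filter_upwards [H, hT] with x hx hTx
    exact ⟨T x, hTx, hx⟩

theorem ofReal_sub_mul_add_ne_zero {x t : ℝ} (hx : 0 < x) (ht : 0 < t) (h : t ≠ x) :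
    (x : ℂ) - t ≠ 0 ∧ (x : ℂ) + t ≠ 0 := by
  constructor
  · rw [← Complex.ofReal_sub]; exact_mod_cast sub_ne_zero.2 h.symm
  · rw [← Complex.ofReal_add]; exact_mod_cast (by positivity : x + t ≠ 0)

/-- Since 1/(x-t) - 1/(x+t) = 2t/(x² - t²), the right-hand side is -b with b the Hilbert transform
of the odd extension, and its Mellin transform is f* times cot(πs/2). -/
theorem solvesReflectedCot_iff {f : ℝ → ℂ} (hf : MemL2HalfLine f) :
    SolvesReflectedCot f ↔
      ∀ᵐ ξ : ℝ, (𝓕 ((memLp_logPull hf).toLp _) : Lp ℂ 2 (volume : Measure ℝ)) (-ξ) * critCos (-ξ) =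
        (𝓕 ((memLp_logPull hf).toLp _) : Lp ℂ 2 (volume : Measure ℝ)) ξ * critCos ξ := by
  obtain ⟨b, hb, hPV, hI, -⟩ := exists_halfLine_hilbert (c := -1) (by norm_num) hf
  have hb' : MemL2HalfLine fun x => -b x := MemLp.neg hb
  have hT : ∀ᵐ x : ℝ ∂(volume.restrict (Ioi (0 : ℝ))), HasPVIntegral
      (fun t => (t : ℂ) * f t / ((t : ℂ) ^ 2 - (x : ℂ) ^ 2)) x (-(1 / 2) * (Real.pi * b x)) := by
    filter_upwards [hPV, ae_restrict_mem measurableSet_Ioi] with x hx hx0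
    refine (hx.const_mul (-(1 / 2))).congr fun t ht htx => ?_
    obtain ⟨h1, h2⟩ := ofReal_sub_mul_add_ne_zero hx0 ht htx
    have h3 : (t : ℂ) ^ 2 - (x : ℂ) ^ 2 ≠ 0 := by
      rw [show (t : ℂ) ^ 2 - (x : ℂ) ^ 2 = -(((x : ℂ) - t) * (x + t)) by ring]
      exact neg_ne_zero.2 (mul_ne_zero h1 h2)
    field_simp
    ring
  have hπ' : (Real.pi : ℂ) ≠ 0 := by exact_mod_cast Real.pi_pos.ne'
  have hw : ∀ x, 2 / (Real.pi : ℂ) * (-(1 / 2) * (Real.pi * b x)) = -b x := fun x => by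
    field_simp
  rw [SolvesReflectedCot, ae_exists_hasPVIntegral_iff hT]
  simp only [hw]
  rw [one_div_mul_comp_one_div_ae_eq_iff hf hb']
  have hm := fourier_logPull_mul_critCos_ae_eq hf hb' fun ε hε =>
    mul_left_cancel₀ (by norm_num) (hI ε hε)
  constructor <;> intro h <;> filter_upwards [h, hm] with ξ h1 h2
  · rw [h1, h2]
  · exact mul_right_cancel₀ (critCos_ne_zero (-ξ)) (h1.trans h2)

/-- Since 1/(x-t) + 1/(x+t) = 2x/(x² - t²), the right-hand side is b for the even extension, with
multiplier tan(πs/2). The double negation is D(-ξ) for D(ξ) = `critCos (-ξ)`. -/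
theorem solvesReflectedTan_iff {f : ℝ → ℂ} (hf : MemL2HalfLine f) :
    SolvesReflectedTan f ↔
      ∀ᵐ ξ : ℝ, (𝓕 ((memLp_logPull hf).toLp _) : Lp ℂ 2 (volume : Measure ℝ)) (-ξ) *
          critCos (- -ξ) =
        (𝓕 ((memLp_logPull hf).toLp _) : Lp ℂ 2 (volume : Measure ℝ)) ξ * critCos (-ξ) := by
  obtain ⟨b, hb, hPV, -, hI⟩ := exists_halfLine_hilbert (c := 1) (by norm_num) hf
  have hT : ∀ᵐ x : ℝ ∂(volume.restrict (Ioi (0 : ℝ))), HasPVIntegral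
      (fun t => (x : ℂ) * f t / ((x : ℂ) ^ 2 - (t : ℂ) ^ 2)) x (1 / 2 * (Real.pi * b x)) := by
    filter_upwards [hPV, ae_restrict_mem measurableSet_Ioi] with x hx hx0
    refine (hx.const_mul (1 / 2)).congr fun t ht htx => ?_
    obtain ⟨h1, h2⟩ := ofReal_sub_mul_add_ne_zero hx0 ht htx
    have h3 : (x : ℂ) ^ 2 - (t : ℂ) ^ 2 ≠ 0 := by
      rw [sq_sub_sq]
      exact mul_ne_zero h2 h1
    field_simp
    ring
  have hπ' : (Real.pi : ℂ) ≠ 0 := by exact_mod_cast Real.pi_pos.ne'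
  have hw : ∀ x, 2 / (Real.pi : ℂ) * (1 / 2 * (Real.pi * b x)) = b x := fun x => by
    field_simp
  rw [SolvesReflectedTan, ae_exists_hasPVIntegral_iff hT]
  simp only [hw, neg_neg]
  rw [one_div_mul_comp_one_div_ae_eq_iff hf hb]
  have hm := fourier_logPull_mul_critCos_ae_eq hb hf fun ε hε =>
    mul_left_cancel₀ (by norm_num) (hI ε hε)
  constructor <;> intro h <;> filter_upwards [h, hm] with ξ h1 h2
  · rw [h1, h2]
  · exact mul_right_cancel₀ (critCos_ne_zero ξ) (h1.trans h2.symm)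

theorem HasPVIntegral.const_mul_iff {k k' : ℝ → ℂ} {a : ℝ} {v : ℂ} {d : ℂ} (hd : d ≠ 0)
    (hk : ∀ t, k' t = d * k t) : HasPVIntegral k' a (d * v) ↔ HasPVIntegral k a v := by
  refine ⟨fun h => ?_, fun h => (h.const_mul d).congr fun t _ _ => (hk t).symm⟩
  have := h.const_mul d⁻¹
  rw [inv_mul_cancel_left₀ hd] at this
  exact this.congr fun t _ _ => by rw [hk, inv_mul_cancel_left₀ hd]

/-- Replacing x by 1/x leaves t alone: both truncations remove the same interval about 1/x, and the
kernels differ by the constant factor x. -/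
theorem solvesReflectedCot_iff_solvesSecondKindCot (f : ℝ → ℂ) :
    SolvesReflectedCot f ↔ SolvesSecondKindCot f := by
  rw [SolvesReflectedCot, SolvesSecondKindCot, ← ae_Ioi_one_div_iff]
  have hae : ∀ᵐ x : ℝ ∂(volume.restrict (Ioi (0 : ℝ))), x ∈ Ioi (0 : ℝ) :=
    ae_restrict_mem measurableSet_Ioi
  refine eventually_congr ?_
  filter_upwards [hae] with x hx
  have hx' : (x : ℂ) ≠ 0 := by exact_mod_cast (show (0 : ℝ) < x from hx).ne'
  have hk : ∀ t : ℝ, (t : ℂ) * f t / ((t : ℂ) ^ 2 - ((1 / x : ℝ) : ℂ) ^ 2) =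
      x * ((x : ℂ) * (t : ℂ) * f t / ((x : ℂ) ^ 2 * (t : ℂ) ^ 2 - 1)) := by
    intro t
    have : (t : ℂ) ^ 2 - ((1 / x : ℝ) : ℂ) ^ 2 = ((x : ℂ) ^ 2 * (t : ℂ) ^ 2 - 1) / (x : ℂ) ^ 2 := by
      push_cast; field_simp
    rw [this, div_div_eq_mul_div]
    ring
  have he : 1 / ((1 / x : ℝ) : ℂ) * f (1 / (1 / x)) = x * f x := by
    rw [one_div_one_div]; push_cast; rw [one_div_one_div]
  rw [he]
  constructor
  · rintro ⟨v, hv, h⟩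
    refine ⟨(x : ℂ)⁻¹ * v, ?_, ?_⟩
    · rw [← HasPVIntegral.const_mul_iff hx' hk, mul_inv_cancel_left₀ hx']
      exact hv
    · refine mul_left_cancel₀ hx' (h.trans ?_)
      field_simp
  · rintro ⟨v, hv, h⟩
    refine ⟨x * v, (HasPVIntegral.const_mul_iff hx' hk).2 hv, ?_⟩
    rw [h]; ring

theorem solvesReflectedTan_iff_solvesSecondKindTan (f : ℝ → ℂ) :
    SolvesReflectedTan f ↔ SolvesSecondKindTan f := by
  rw [SolvesReflectedTan, SolvesSecondKindTan, ← ae_Ioi_one_div_iff]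
  have hae : ∀ᵐ x : ℝ ∂(volume.restrict (Ioi (0 : ℝ))), x ∈ Ioi (0 : ℝ) :=
    ae_restrict_mem measurableSet_Ioi
  refine eventually_congr ?_
  filter_upwards [hae] with x hx
  have hx' : (x : ℂ) ≠ 0 := by exact_mod_cast (show (0 : ℝ) < x from hx).ne'
  have hk : ∀ t : ℝ, ((1 / x : ℝ) : ℂ) * f t / (((1 / x : ℝ) : ℂ) ^ 2 - (t : ℂ) ^ 2) =
      x * (f t / (1 - (x : ℂ) ^ 2 * (t : ℂ) ^ 2)) := by
    intro t
    have : ((1 / x : ℝ) : ℂ) ^ 2 - (t : ℂ) ^ 2 = (1 - (x : ℂ) ^ 2 * (t : ℂ) ^ 2) / (x : ℂ) ^ 2 := by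
      push_cast; field_simp
    rw [this, div_div_eq_mul_div]
    push_cast
    field_simp
  have he : 1 / ((1 / x : ℝ) : ℂ) * f (1 / (1 / x)) = x * f x := by
    rw [one_div_one_div]; push_cast; rw [one_div_one_div]
  rw [he]
  constructor
  · rintro ⟨v, hv, h⟩
    refine ⟨(x : ℂ)⁻¹ * v, ?_, ?_⟩
    · rw [← HasPVIntegral.const_mul_iff hx' hk, mul_inv_cancel_left₀ hx']
      exact hv
    · refine mul_left_cancel₀ hx' (h.trans ?_)
      field_simp
  · rintro ⟨v, hv, h⟩
    refine ⟨x * v, (HasPVIntegral.const_mul_iff hx' hk).2 hv, ?_⟩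
    rw [h]; ring

theorem corollary2 (f : ℝ → ℂ) (hf : MemL2HalfLine f) :
    List.TFAE [
      SolvesReflectedCot f,
      SolvesSecondKindCot f,
      ∃ φ : ℂ → ℂ, SymmetricOnCritLine φ ∧
        IsMeanSquareMellinIntegral (fun s => φ s / Complex.cos ((Real.pi : ℂ) * s / 2)) f,
      ∃ φ : ℂ → ℂ, SymmetricOnCritLine φ ∧
        IsMellinTransformL2 f (fun s => φ s / Complex.cos ((Real.pi : ℂ) * s / 2))] ∧
    List.TFAE [
      SolvesReflectedTan f,
      SolvesSecondKindTan f,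
      ∃ ρ : ℂ → ℂ, SymmetricOnCritLine ρ ∧
        IsMeanSquareMellinIntegral (fun s => ρ s / Complex.sin ((Real.pi : ℂ) * s / 2)) f,
      ∃ ρ : ℂ → ℂ, SymmetricOnCritLine ρ ∧
        IsMellinTransformL2 f (fun s => ρ s / Complex.sin ((Real.pi : ℂ) * s / 2))] :=
  ⟨tfae_mellin_conditions hf (den := fun s => Complex.cos ((Real.pi : ℂ) * s / 2))
      (fun _ => rfl) critCos_ne_zero (solvesReflectedCot_iff_solvesSecondKindCot f)
      (solvesReflectedCot_iff hf),
    tfae_mellin_conditions hf (den := fun s => Complex.sin ((Real.pi : ℂ) * s / 2))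
      (fun ξ => (critCos_neg ξ).symm) (fun ξ => critCos_ne_zero (-ξ))
      (solvesReflectedTan_iff_solvesSecondKindTan f) (solvesReflectedTan_iff hf)⟩
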